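/- An identification of two distinct vertices $u,v$ of a graph replaces $u$ and $v$ by one new vertex that is adjacent to exactly those remaining vertices that were adjacent to $u$ or to $v$. For a class $\mathcal H$ of graphs (closed under isomorphism), the problem $\mathcal H$-Identification asks, given a finite simple undirected graph $G$ and an integer $k\ge 0$, whether $G$ can be transformed into a graph in $\mathcal H$ by at most $k$ identifications. A path is a graph $P_\ell$ with $\ell\ge 1$ vertices $v_1,\dots,v_\ell$ and edges $v_iv_{i+1}$ $(1\le i<\ell)$, and a linear forest is a finite graph each of whose connected components is a path. Theorem. $\mathcal H$-Identification can be solved in $\mathcal O(nm)$ time, where $n$ and $m$ are the numbers of vertices and edges of $G$, if $\mathcal H$ is the class of paths, and also if $\mathcal H$ is the class of linear forests. That is, for each of these two classes there are a constant $C$ and a program for a random access machine (unit cost, with addition, subtraction, comparison and indirect memory access, all numbers written into registers being bounded by $C(n+m+k+1)^C$) that decides every instance $(G,k)$, with $G$ given by adjacency lists, in at most $C\cdot(nm+1)$ steps. -/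

import Mathlib

/-! ### Vertex identifications and graph classes -/

/-- The graph obtained from `G` by identifying the distinct vertices `u` and `v`. The new vertex is
called `u` again (and `v` disappears); it is adjacent to all other vertices that were adjacent to
`u` or to `v`. All other adjacencies are unchanged. -/
def identify {V : Type} (G : SimpleGraph V) (u v : V) : SimpleGraph {x : V // x ≠ v} :=
  SimpleGraph.fromRel fun x y => G.Adj x y ∨ (x.1 = u ∧ G.Adj v y)

/-- `IdentifiesTo G H j`: the graph `G` can be transformed into (a graph isomorphic to) `H` by a
sequence of exactly `j` vertex identifications. -/
inductive IdentifiesTo : {V W : Type} → SimpleGraph V → SimpleGraph W → ℕ → Prop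
  | iso {V W : Type} {G : SimpleGraph V} {H : SimpleGraph W} (e : G ≃g H) : IdentifiesTo G H 0
  | step {V W : Type} {G : SimpleGraph V} {H : SimpleGraph W} {j : ℕ} (u v : V) (huv : u ≠ v)
      (h : IdentifiesTo (identify G u v) H j) : IdentifiesTo G H (j + 1)

/-- A class of graphs. -/
abbrev GraphClass : Type 1 := (V : Type) → SimpleGraph V → Prop

/-- `(G, k)` is a yes-instance of `𝓗`-Identification: `G` can be transformed into some graph in `𝓗`
by at most `k` vertex identifications. -/
def IsYesInstance (𝓗 : GraphClass) {V : Type} (G : SimpleGraph V) (k : ℕ) : Prop :=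
  ∃ (W : Type) (H : SimpleGraph W), 𝓗 W H ∧ ∃ j ≤ k, IdentifiesTo G H j

/-- The class of paths: the graphs isomorphic to `P_ℓ`, the path on `ℓ ≥ 1` vertices. -/
def pathClass : GraphClass := fun _ G =>
  ∃ ℓ : ℕ, 1 ≤ ℓ ∧ Nonempty (G ≃g SimpleGraph.pathGraph ℓ)

/-- The class of linear forests: the finite graphs all of whose connected components are paths
(such a graph is automatically a forest). -/
def linearForestClass : GraphClass := fun V G =>
  Finite V ∧ ∀ c : G.ConnectedComponent, pathClass c c.toSimpleGraph

/-! ### Random access machines -/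

/-- Programs of a random access machine, written in structured form. There is a finite bank of
registers (those that occur in the program) and an addressable memory; both hold natural numbers. -/
inductive RamProgram : Type
  /-- do nothing -/
  | skip
  /-- `reg d := c` -/
  | const (d c : ℕ)
  /-- `reg d := reg a + reg b` -/
  | add (d a b : ℕ)
  /-- `reg d := max (reg a - reg b) 0` -/
  | sub (d a b : ℕ)
  /-- `reg d := mem (reg a)` -/
  | load (d a : ℕ)
  /-- `mem (reg a) := reg b` -/
  | store (a b : ℕ)
  /-- first `P`, then `Q` -/
  | seq (P Q : RamProgram)
  /-- if `reg a < reg b` then `P`, else `Q` -/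
  | ifLt (a b : ℕ) (P Q : RamProgram)
  /-- while `reg a < reg b` do `P` -/
  | whileLt (a b : ℕ) (P : RamProgram)

/-- The contents of the registers and of the memory. -/
structure RamState where
  reg : ℕ → ℕ
  mem : ℕ → ℕ

/-- The state after writing `x` into register `d`. -/
def RamState.setReg (s : RamState) (d x : ℕ) : RamState :=
  { s with reg := Function.update s.reg d x }

/-- The state after writing `x` into the memory cell with address `p`. -/
def RamState.setMem (s : RamState) (p x : ℕ) : RamState :=
  { s with mem := Function.update s.mem p x }

/-- `RamExec B P s t s'`: the program `P`, started in the state `s`, stops in the state `s'` after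
exactly `t` steps, and never writes a number larger than `B` into a register. Each arithmetic
operation, each memory access and each evaluation of a test is one step. -/
inductive RamExec (B : ℕ) : RamProgram → RamState → ℕ → RamState → Prop
  | skip (s : RamState) : RamExec B .skip s 1 s
  | const (s : RamState) (d c : ℕ) (h : c ≤ B) :
      RamExec B (.const d c) s 1 (s.setReg d c)
  | add (s : RamState) (d a b : ℕ) (h : s.reg a + s.reg b ≤ B) :
      RamExec B (.add d a b) s 1 (s.setReg d (s.reg a + s.reg b))
  | sub (s : RamState) (d a b : ℕ) (h : s.reg a - s.reg b ≤ B) :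
      RamExec B (.sub d a b) s 1 (s.setReg d (s.reg a - s.reg b))
  | load (s : RamState) (d a : ℕ) (h : s.mem (s.reg a) ≤ B) :
      RamExec B (.load d a) s 1 (s.setReg d (s.mem (s.reg a)))
  | store (s : RamState) (a b : ℕ) :
      RamExec B (.store a b) s 1 (s.setMem (s.reg a) (s.reg b))
  | seq {P Q : RamProgram} {s₁ s₂ s₃ : RamState} {t₁ t₂ : ℕ}
      (h₁ : RamExec B P s₁ t₁ s₂) (h₂ : RamExec B Q s₂ t₂ s₃) :
      RamExec B (.seq P Q) s₁ (t₁ + t₂) s₃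
  | ifTrue {P Q : RamProgram} {s s' : RamState} {a b t : ℕ}
      (h : s.reg a < s.reg b) (h' : RamExec B P s t s') :
      RamExec B (.ifLt a b P Q) s (t + 1) s'
  | ifFalse {P Q : RamProgram} {s s' : RamState} {a b t : ℕ}
      (h : ¬ s.reg a < s.reg b) (h' : RamExec B Q s t s') :
      RamExec B (.ifLt a b P Q) s (t + 1) s'
  | whileTrue {P : RamProgram} {s₁ s₂ s₃ : RamState} {a b t₁ t₂ : ℕ}
      (h : s₁.reg a < s₁.reg b) (h₁ : RamExec B P s₁ t₁ s₂)
      (h₂ : RamExec B (.whileLt a b P) s₂ t₂ s₃) :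
      RamExec B (.whileLt a b P) s₁ (t₁ + t₂ + 1) s₃
  | whileFalse {P : RamProgram} {s : RamState} {a b : ℕ} (h : ¬ s.reg a < s.reg b) :
      RamExec B (.whileLt a b P) s 1 s

/-- Runs are deterministic: the program and the initial state determine the running time and the
final state. -/
theorem RamExec.deterministic {B : ℕ} {P : RamProgram} {s s₁ s₂ : RamState} {t₁ t₂ : ℕ}
    (h₁ : RamExec B P s t₁ s₁) (h₂ : RamExec B P s t₂ s₂) : t₁ = t₂ ∧ s₁ = s₂ := by
  induction h₁ generalizing t₂ s₂ with
  | seq _ _ ih₁ ih₂ =>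
    cases h₂ with
    | seq g₁ g₂ =>
      obtain ⟨rfl, rfl⟩ := ih₁ g₁
      obtain ⟨rfl, rfl⟩ := ih₂ g₂
      exact ⟨rfl, rfl⟩
  | ifTrue h _ ih =>
    cases h₂ with
    | ifTrue _ g => obtain ⟨rfl, rfl⟩ := ih g; exact ⟨rfl, rfl⟩
    | ifFalse h' _ => exact absurd h h'
  | ifFalse h _ ih =>
    cases h₂ with
    | ifTrue h' _ => exact absurd h' h
    | ifFalse _ g => obtain ⟨rfl, rfl⟩ := ih g; exact ⟨rfl, rfl⟩
  | whileTrue h _ _ ih₁ ih₂ =>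
    cases h₂ with
    | whileTrue _ g₁ g₂ =>
      obtain ⟨rfl, rfl⟩ := ih₁ g₁
      obtain ⟨rfl, rfl⟩ := ih₂ g₂
      exact ⟨rfl, rfl⟩
    | whileFalse h' => exact absurd h h'
  | whileFalse h =>
    cases h₂ with
    | whileTrue h' _ _ => exact absurd h' h
    | whileFalse _ => exact ⟨rfl, rfl⟩
  | _ => cases h₂; exact ⟨rfl, rfl⟩

/-! ### Inputs and running times -/

/-- `adj` is an adjacency-list representation of `G`: the list of `v` contains every neighbour of
`v` exactly once, in an arbitrary order, and nothing else. -/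
def IsAdjacencyList {n : ℕ} (G : SimpleGraph (Fin n)) (adj : Fin n → List (Fin n)) : Prop :=
  ∀ v, (adj v).Nodup ∧ ∀ w, w ∈ adj v ↔ G.Adj v w

/-- The address at which the list of the vertex `v` begins. The lists of the vertices `0, …, n - 1`
are stored one after the other, and the first one begins at the address `n + 3`, behind `n`, `k` and
`n + 1` pointers. For `v = n` this is the address at which the last list ends. -/
def listAddress {n : ℕ} (adj : Fin n → List (Fin n)) (v : ℕ) : ℕ :=
  n + 3 + ∑ u : Fin n with u.1 < v, (adj u).length

/-- The input of the machine for the instance `(G, k)`, where `G` is given by adjacency lists: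
`n`, then `k`, then the `n + 1` pointers to the beginnings of the lists (the list of `v` ends where
the pointer of `v + 1` points), then the lists themselves. -/
def inputWords {n : ℕ} (adj : Fin n → List (Fin n)) (k : ℕ) : List ℕ :=
  n :: k :: (List.range (n + 1)).map (listAddress adj) ++
    (List.ofFn adj).flatten.map Fin.val

/-- The initial state: all registers are `0`, the memory holds the input from address `0` on, and
all other memory cells are `0`. -/
def initialState (input : List ℕ) : RamState where
  reg := fun _ => 0
  mem := fun i => input.getD i 0

/-- `𝓗`-Identification is solvable in `O(T(n, m))` time, where `n` and `m` are the numbers of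
vertices and of edges of the input graph: there are a single program of a random access machine and
a constant `C` such that the program, on every instance `(G, k)`, stops after at most `C · T(n, m)`
steps with the correct answer in register `0` (`1` for yes, `0` for no). The machine works with
words of logarithmic length: all numbers in the run are at most polynomial in `n + m + k`. -/
def SolvableInTime (𝓗 : GraphClass) (T : ℕ → ℕ → ℕ) : Prop :=
  ∃ (P : RamProgram) (C : ℕ), ∀ (n : ℕ) (G : SimpleGraph (Fin n)) (adj : Fin n → List (Fin n)),
    IsAdjacencyList G adj → ∀ k : ℕ, ∃ (t : ℕ) (s : RamState),
      RamExec (C * (n + G.edgeSet.ncard + k + 1) ^ C) P (initialState (inputWords adj k)) t s ∧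
      t ≤ C * T n G.edgeSet.ncard ∧
      (IsYesInstance 𝓗 G k → s.reg 0 = 1) ∧ (¬ IsYesInstance 𝓗 G k → s.reg 0 = 0)

/-! A sequence of identifications amounts to a surjection whose target carries exactly the edges
induced from `G`, and its length is the number of vertices lost (`isYesInstance_iff`). The question
is therefore how large a quotient in the class can be.

An edge of `G` is mapped to an edge or collapsed to a point, so a map to a path is 1-Lipschitz on
each component `K`, and the image of `K` lies in an interval with at most diam `K` edges. In a path
every edge must come from some component, so a path quotient has at most 1 + Σ diam `K` vertices
(`IsQuotientMap.card_path_le`). In a linear forest each component is mapped into a single path, and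
counting vertices gives Σ (diam `K` + 1) (`IsQuotientMap.card_linearForest_le`). Both bounds are
attained: collapse the distance layers from a vertex of maximum eccentricity in each component, and
either chain the resulting paths end to end (`exists_isQuotientMap_path`) or keep them disjoint
(`exists_isQuotientMap_pathUnion`).

Diameters are computed by a breadth-first search from every vertex. A search reports the
eccentricity of its source and the least vertex of the component, under which the maximum
eccentricity is recorded; the sum of these maxima is updated along the way. The distance array is
never cleared: each search writes values at least as large as a base that exceeds all older values,
so smaller entries count as undiscovered. The base grows by at most `n` per search and stays
quadratic.

A search costs O(m + 1), which gives O(nm + n) in total. This is O(nm) when there is an edge.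
Edgeless graphs have a constant budget and are answered directly from `n` and `k`. -/

/-! ### Identifications as quotient maps -/

/-- `f` exhibits `H` as the simple graph quotient of `G`: `f` is surjective, and distinct vertices
of `H` are adjacent exactly if some edge of `G` joins their fibres. -/
structure IsQuotientMap {V W : Type} (G : SimpleGraph V) (H : SimpleGraph W) (f : V → W) :
    Prop where
  surjective : Function.Surjective f
  adj_iff : ∀ a b, H.Adj a b ↔ a ≠ b ∧ ∃ x y, f x = a ∧ f y = b ∧ G.Adj x y

namespace IsQuotientMap

variable {U V W : Type} {F : SimpleGraph U} {G : SimpleGraph V} {H : SimpleGraph W}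

theorem comp {f : U → V} {g : V → W} (hg : IsQuotientMap G H g) (hf : IsQuotientMap F G f) :
    IsQuotientMap F H (g ∘ f) where
  surjective := hg.surjective.comp hf.surjective
  adj_iff a b := by
    rw [hg.adj_iff]
    refine and_congr_right fun hab => ⟨?_, ?_⟩
    · rintro ⟨x, y, rfl, rfl, h⟩
      obtain ⟨-, x', y', hx, hy, h'⟩ := (hf.adj_iff _ _).1 h
      exact ⟨x', y', by simp [hx], by simp [hy], h'⟩
    · rintro ⟨x, y, rfl, rfl, h⟩
      refine ⟨f x, f y, rfl, rfl, (hf.adj_iff _ _).2 ⟨fun h' => hab (congrArg g h'), x, y, rfl, rfl, h⟩⟩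

/-- Used to peel one identification off a given quotient map. -/
theorem of_comp {f : U → V} {g : V → W} (hgf : IsQuotientMap F H (g ∘ f))
    (hf : IsQuotientMap F G f) : IsQuotientMap G H g where
  surjective := hgf.surjective.of_comp
  adj_iff a b := by
    rw [hgf.adj_iff]
    refine and_congr_right fun hab => ⟨?_, ?_⟩
    · rintro ⟨x, y, rfl, rfl, h⟩
      refine ⟨f x, f y, rfl, rfl, (hf.adj_iff _ _).2 ⟨fun h' => hab (congrArg g h'), x, y, rfl, rfl, h⟩⟩
    · rintro ⟨x, y, rfl, rfl, h⟩
      obtain ⟨-, x', y', hx, hy, h'⟩ := (hf.adj_iff _ _).1 h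
      exact ⟨x', y', by simp [hx], by simp [hy], h'⟩

theorem of_iso (e : G ≃g H) : IsQuotientMap G H e where
  surjective := e.surjective
  adj_iff a b := by
    refine ⟨fun h => ⟨h.ne, e.symm a, e.symm b, by simp, by simp, e.symm.map_adj_iff.2 h⟩, ?_⟩
    rintro ⟨-, x, y, rfl, rfl, h⟩
    exact e.map_adj_iff.2 h

/-- A bijective quotient map is an isomorphism. -/
noncomputable def toIso {f : V → W} (hf : IsQuotientMap G H f) (hb : Function.Bijective f) : G ≃g H where
  toEquiv := Equiv.ofBijective f hb
  map_rel_iff' {x y} := by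
    simp only [Equiv.ofBijective_apply, hf.adj_iff]
    constructor
    · rintro ⟨-, x', y', hx, hy, h⟩
      rwa [hb.1 hx, hb.1 hy] at h
    · intro h
      exact ⟨hb.1.ne h.ne, x, y, rfl, rfl, h⟩

end IsQuotientMap

open Classical in
/-- The map that sends `v` to `u` and fixes all other vertices. -/
noncomputable def collapse {V : Type} (u v : V) (huv : u ≠ v) (x : V) : {x : V // x ≠ v} :=
  if h : x = v then ⟨u, huv⟩ else ⟨x, h⟩

theorem isQuotientMap_collapse {V : Type} (G : SimpleGraph V) (u v : V) (huv : u ≠ v) :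
    IsQuotientMap G (identify G u v) (collapse u v huv) where
  surjective x := ⟨x.1, by simp [collapse, x.2]⟩
  adj_iff := by
    rintro ⟨a, ha⟩ ⟨b, hb⟩
    simp only [identify, SimpleGraph.fromRel_adj]
    refine and_congr_right fun hab => ⟨?_, ?_⟩
    · rintro ((h | ⟨rfl, h⟩) | (h | ⟨rfl, h⟩))
      · exact ⟨a, b, by simp [collapse, ha], by simp [collapse, hb], h⟩
      · exact ⟨v, b, by simp [collapse], by simp [collapse, hb], h⟩
      · exact ⟨a, b, by simp [collapse, ha], by simp [collapse, hb], h.symm⟩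
      · exact ⟨a, v, by simp [collapse, ha], by simp [collapse], h.symm⟩
    · rintro ⟨x, y, hx, hy, h⟩
      by_cases h1 : x = v <;> by_cases h2 : y = v
      · exact absurd (h1.trans h2.symm) h.ne
      · simp only [collapse, h1, h2, dite_true, dite_false, Subtype.mk.injEq] at hx hy
        subst hx hy h1
        exact Or.inl (Or.inr ⟨rfl, h⟩)
      · simp only [collapse, h1, h2, dite_true, dite_false, Subtype.mk.injEq] at hx hy
        subst hx hy h2
        exact Or.inr (Or.inr ⟨rfl, h.symm⟩)
      · simp only [collapse, h1, h2, dite_false, Subtype.mk.injEq] at hx hy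
        subst hx hy
        exact Or.inl (Or.inl h)

theorem card_subtype_ne_add_one {V : Type} [Finite V] (v : V) :
    Nat.card {x : V // x ≠ v} + 1 = Nat.card V := by
  classical
  have := Fintype.ofFinite V
  have h : 0 < Fintype.card V := Fintype.card_pos_iff.2 ⟨v⟩
  rw [Nat.card_eq_fintype_card, Nat.card_eq_fintype_card, Fintype.card_subtype_compl,
    Fintype.card_subtype_eq]
  omega

theorem IdentifiesTo.exists_isQuotientMap {V W : Type} {G : SimpleGraph V} {H : SimpleGraph W}
    {j : ℕ} (h : IdentifiesTo G H j) (hV : Finite V) :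
    ∃ f : V → W, IsQuotientMap G H f ∧ Nat.card V = Nat.card W + j := by
  induction h with
  | iso e => exact ⟨e, .of_iso e, Nat.card_congr e.toEquiv⟩
  | step u v huv _ ih =>
    obtain ⟨f, hf, hc⟩ := ih Subtype.finite
    refine ⟨_, hf.comp (isQuotientMap_collapse _ u v huv), ?_⟩
    rw [← card_subtype_ne_add_one v, hc, add_assoc]

/-- While vertices remain to be lost, `f` merges some pair `u`, `v`. It then factors through the
collapse of that pair, and the induced map is again a quotient map. Once the cardinalities agree,
`f` is bijective and hence an isomorphism. -/
theorem IsQuotientMap.identifiesTo {V W : Type} [Finite V] {G : SimpleGraph V}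
    {H : SimpleGraph W} {f : V → W} (hf : IsQuotientMap G H f) {j : ℕ}
    (hj : Nat.card V = Nat.card W + j) : IdentifiesTo G H j := by
  induction j generalizing V with
  | zero => exact .iso (hf.toIso (hf.surjective.bijective_of_nat_card_le (by omega)))
  | succ j ih =>
    have hinj : ¬ Function.Injective f := fun hi => by
      have := Nat.card_eq_of_bijective f ⟨hi, hf.surjective⟩
      omega
    simp only [Function.Injective, not_forall] at hinj
    obtain ⟨u, v, h, huv⟩ := hinj
    have hfc : (fun x : {x : V // x ≠ v} => f x.1) ∘ collapse u v huv = f := by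
      funext x
      by_cases hx : x = v
      · subst hx
        simp [collapse, h]
      · simp [collapse, hx]
    have hq := isQuotientMap_collapse G u v huv
    refine .step u v huv (ih (f := fun x => f x.1) (.of_comp (hfc.symm ▸ hf) hq) ?_)
    have := card_subtype_ne_add_one v
    omega

theorem isYesInstance_iff {𝓗 : GraphClass} {V : Type} [Finite V] {G : SimpleGraph V} {k : ℕ} :
    IsYesInstance 𝓗 G k ↔ ∃ (W : Type) (H : SimpleGraph W), 𝓗 W H ∧
      (∃ f : V → W, IsQuotientMap G H f) ∧ Nat.card V ≤ Nat.card W + k := by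
  constructor
  · rintro ⟨W, H, hH, j, hj, h⟩
    obtain ⟨f, hf, hc⟩ := h.exists_isQuotientMap inferInstance
    exact ⟨W, H, hH, ⟨f, hf⟩, by omega⟩
  · rintro ⟨W, H, hH, ⟨f, hf⟩, hc⟩
    have := Nat.card_le_card_of_surjective f hf.surjective
    exact ⟨W, H, hH, Nat.card V - Nat.card W, by omega, hf.identifiesTo (by omega)⟩

/-! ### Eccentricities and diameters of components -/

namespace SimpleGraph

variable {V : Type} {G : SimpleGraph V}

theorem Adj.dist_le_succ {x y : V} (h : G.Adj x y) (s : V) : G.dist s y ≤ G.dist s x + 1 := by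
  have := h.diff_dist_adj (u := s)
  omega

theorem exists_adj_of_dist_eq_succ {s z : V} {d : ℕ} (h : G.dist s z = d + 1) :
    ∃ y, G.Adj y z ∧ G.dist s y = d := by
  obtain ⟨p, hp⟩ := exists_walk_of_dist_ne_zero (G := G) (u := s) (v := z) (by omega)
  have hnil : ¬ p.Nil := by
    rw [← Walk.length_eq_zero_iff]
    omega
  refine ⟨p.penultimate, p.adj_penultimate hnil, ?_⟩
  have h1 := dist_le p.dropLast
  have h2 := (p.adj_penultimate hnil).dist_le_succ s
  have h3 : p.dropLast.length + 1 = p.length := by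
    simp only [Walk.length_dropLast]
    omega
  omega

/-- Walking back along a shortest path shows that no distance layer up to the layer of `z` is empty.
This yields surjectivity of the layer maps. -/
theorem exists_reachable_dist_eq {s z : V} {d e : ℕ} (h : G.dist s z = e) (hz : G.Reachable s z)
    (hd : d ≤ e) : ∃ y, G.Reachable s y ∧ G.dist s y = d := by
  induction e generalizing z with
  | zero => exact ⟨z, hz, by omega⟩
  | succ e ih =>
    rcases Nat.lt_or_eq_of_le hd with hlt | rfl
    · obtain ⟨y, hyz, hy⟩ := exists_adj_of_dist_eq_succ h
      exact ih hy (hz.trans hyz.symm.reachable) (by omega)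
    · exact ⟨z, hz, h⟩

theorem Reachable.le_add_dist {F : V → ℕ} (hF : ∀ x y, G.Adj x y → F y ≤ F x + 1) {x y : V}
    (h : G.Reachable x y) : F y ≤ F x + G.dist x y := by
  obtain ⟨p, hp⟩ := h.exists_walk_length_eq_dist
  rw [← hp]
  clear hp h
  induction p with
  | nil => simp
  | cons h p ih =>
    have := hF _ _ h
    rw [Walk.length_cons]
    omega

end SimpleGraph

section

variable {n : ℕ} (G : SimpleGraph (Fin n))

/-- The largest distance from `s` to a vertex of its component. -/
noncomputable def ecc (s : Fin n) : ℕ := Finset.univ.sup fun v => G.dist s v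

open Classical in
/-- The least vertex of the component of `s`. -/
noncomputable def rep (s : Fin n) : Fin n :=
  (Finset.univ.filter (G.Reachable s)).min' ⟨s, by simp⟩

/-- The maximum of `ecc s + δ` over the vertices `s` of the component represented by `r`, and `0`
if there is no such component. -/
noncomputable def compDiam (δ : ℕ) (r : Fin n) : ℕ :=
  (Finset.univ.filter (rep G · = r)).sup fun s => ecc G s + δ

variable {G}

theorem dist_le_ecc (s v : Fin n) : G.dist s v ≤ ecc G s :=
  Finset.le_sup (f := fun v => G.dist s v) (Finset.mem_univ v)

/-- Distances between different components are `0` by convention, so the supremum over all vertices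
is attained inside the component of `s`. -/
theorem exists_dist_eq_ecc (s : Fin n) : ∃ v, G.Reachable s v ∧ G.dist s v = ecc G s := by
  obtain ⟨v, -, hv⟩ := Finset.exists_mem_eq_sup Finset.univ ⟨s, Finset.mem_univ s⟩
    fun v => G.dist s v
  by_cases h : ecc G s = 0
  · exact ⟨s, .rfl, by simp [h]⟩
  · exact ⟨v, .of_dist_ne_zero (hv ▸ h), hv.symm⟩

theorem rep_eq_iff {s r : Fin n} :
    rep G s = r ↔ G.Reachable s r ∧ ∀ x, G.Reachable s x → r ≤ x := by
  classical
  exact (Finset.min'_eq_iff _ _ _).trans (by simp)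

theorem reachable_rep (s : Fin n) : G.Reachable s (rep G s) := (rep_eq_iff.1 rfl).1

theorem rep_eq_rep_iff {s t : Fin n} : rep G s = rep G t ↔ G.Reachable s t := by
  constructor
  · intro h
    exact (reachable_rep s).trans (h ▸ (reachable_rep t).symm)
  · intro h
    obtain ⟨h1, h2⟩ := rep_eq_iff.1 (rfl : rep G t = rep G t)
    exact rep_eq_iff.2 ⟨h.trans h1, fun x hx => h2 x (h.symm.trans hx)⟩

theorem ecc_add_le_compDiam (δ : ℕ) (s : Fin n) : ecc G s + δ ≤ compDiam G δ (rep G s) :=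
  Finset.le_sup (f := fun s => ecc G s + δ) (by simp)

theorem exists_ecc_add_eq_compDiam (δ : ℕ) {s r : Fin n} (h : rep G s = r) :
    ∃ t, rep G t = r ∧ compDiam G δ r = ecc G t + δ := by
  obtain ⟨t, ht, ht'⟩ := Finset.exists_mem_eq_sup (Finset.univ.filter (rep G · = r))
    ⟨s, by simp [h]⟩ fun s => ecc G s + δ
  exact ⟨t, by simpa using ht, ht'⟩

/-- Take `t` to minimise `F` on the component. The Lipschitz property then confines `F` to an
interval starting at `F t` whose length is the eccentricity of `t`, hence at most the diameter. -/
theorem exists_base_vertex {F : Fin n → ℕ} {s r : Fin n} (h : rep G s = r)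
    (hF : ∀ x y, rep G x = r → G.Adj x y → F y ≤ F x + 1) :
    ∃ t, rep G t = r ∧ ∀ y, rep G y = r → F t ≤ F y ∧ F y ≤ F t + ecc G t := by
  obtain ⟨t, ht, htmin⟩ := (Finset.univ.filter (rep G · = r)).exists_min_image F ⟨s, by simp [h]⟩
  simp only [Finset.mem_filter, Finset.mem_univ, true_and] at ht htmin
  refine ⟨t, ht, fun y hy => ⟨htmin y hy, ?_⟩⟩
  have hty : G.Reachable t y := rep_eq_rep_iff.1 (ht.trans hy.symm)
  -- Extension by zero makes the Lipschitz condition global, since no edge leaves the component.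
  have := hty.le_add_dist (F := fun x => if rep G x = r then F x else 0) fun a b hab => by
    have hab' := rep_eq_rep_iff.2 hab.reachable
    rw [← hab']
    split_ifs with ha
    · exact hF a b ha hab
    · omega
  simp only [ht, hy, if_true] at this
  have := dist_le_ecc (G := G) t y
  omega

theorem compDiam_le {δ : ℕ} {r : Fin n} {c : ℕ} (h : ∀ s, rep G s = r → ecc G s + δ ≤ c) :
    compDiam G δ r ≤ c :=
  Finset.sup_le fun s hs => h s (by simpa using hs)

/-- For an `r` that represents no component both maxima are over the empty set. Thus adding `1`
inside the maximum counts only actual components when summing over all vertices. -/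
theorem compDiam_one_of_rep {s r : Fin n} (h : rep G s = r) :
    compDiam G 1 r = compDiam G 0 r + 1 := by
  apply le_antisymm
  · exact compDiam_le fun t ht => by
      subst ht
      have := ecc_add_le_compDiam (G := G) 0 t
      omega
  · obtain ⟨t, rfl, ht'⟩ := exists_ecc_add_eq_compDiam 0 h
    have := ecc_add_le_compDiam (G := G) 1 t
    omega

end

/-! ### Partial sums -/

theorem sum_filter_lt_succ {n : ℕ} (d : Fin n → ℕ) (i : Fin n) :
    ∑ r : Fin n with r.1 < i.1 + 1, d r = (∑ r : Fin n with r.1 < i.1, d r) + d i := by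
  have : (Finset.univ.filter fun r : Fin n => r.1 < i.1 + 1) =
      insert i (Finset.univ.filter fun r : Fin n => r.1 < i.1) := by
    ext r
    simp only [Finset.mem_filter, Finset.mem_univ, true_and, Finset.mem_insert, Fin.ext_iff]
    omega
  rw [this, Finset.sum_insert (by simp), add_comm]

theorem sum_filter_lt_card {n : ℕ} (d : Fin n → ℕ) :
    ∑ r : Fin n with r.1 < n, d r = ∑ r, d r := by
  simp

theorem sum_filter_lt_mono {n : ℕ} (d : Fin n → ℕ) {i j : ℕ} (h : i ≤ j) :
    ∑ r : Fin n with r.1 < i, d r ≤ ∑ r : Fin n with r.1 < j, d r := by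
  apply Finset.sum_le_sum_of_subset
  intro r
  simp only [Finset.mem_filter, Finset.mem_univ, true_and]
  omega

theorem exists_between_partial_sums {n : ℕ} (d : Fin n → ℕ) {i : ℕ} (h : i < ∑ r, d r) :
    ∃ r : Fin n, ∑ x : Fin n with x.1 < r.1, d x ≤ i ∧
      i < (∑ x : Fin n with x.1 < r.1, d x) + d r := by
  have hex : ∃ j, i < ∑ x : Fin n with x.1 < j, d x := ⟨n, by rwa [sum_filter_lt_card]⟩
  classical
  obtain ⟨hj, hmin⟩ := And.intro (Nat.find_spec hex) fun m => @Nat.find_min _ _ hex m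
  have hjn : Nat.find hex ≤ n := Nat.find_min' hex (by rwa [sum_filter_lt_card])
  generalize Nat.find hex = j at *
  cases j with
  | zero => simp at hj
  | succ j =>
    refine ⟨⟨j, hjn⟩, not_lt.1 (hmin _ (Nat.lt_succ_self j)), ?_⟩
    rwa [← sum_filter_lt_succ d ⟨j, hjn⟩]

/-! ### Identification to paths -/

theorem IsQuotientMap.reachable {V W : Type} {G : SimpleGraph V} {H : SimpleGraph W} {f : V → W}
    (hf : IsQuotientMap G H f) {x y : V} (h : G.Reachable x y) : H.Reachable (f x) (f y) := by
  obtain ⟨p⟩ := h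
  induction p with
  | nil => exact .rfl
  | @cons a b c hab p ih =>
    refine SimpleGraph.Reachable.trans ?_ ih
    by_cases h : f a = f b
    · rw [h]
    · exact ((hf.adj_iff _ _).2 ⟨h, a, b, rfl, rfl, hab⟩).reachable

section

variable {n : ℕ} {G : SimpleGraph (Fin n)}

theorem IsQuotientMap.card_path_le {ℓ : ℕ} {f : Fin n → Fin ℓ}
    (hf : IsQuotientMap G (SimpleGraph.pathGraph ℓ) f) : ℓ ≤ 1 + ∑ r, compDiam G 0 r := by
  classical
  have hlip : ∀ x y, G.Adj x y → (f y).1 ≤ (f x).1 + 1 := fun x y hxy => by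
    by_cases h : f x = f y
    · rw [h]; omega
    · have := (hf.adj_iff _ _).2 ⟨h, x, y, rfl, rfl, hxy⟩
      rw [SimpleGraph.pathGraph_adj] at this
      omega
  have hbase : ∀ r, ∃ a, ∀ y, rep G y = r → a ≤ (f y).1 ∧ (f y).1 ≤ a + compDiam G 0 r := by
    intro r
    by_cases h : ∃ s, rep G s = r
    · obtain ⟨s, hs⟩ := h
      obtain ⟨t, rfl, ht'⟩ := exists_base_vertex hs (F := fun x => (f x).1)
        fun x y _ hxy => hlip x y hxy
      have := ecc_add_le_compDiam (G := G) 0 t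
      exact ⟨_, fun y hy => ⟨(ht' y hy).1, (ht' y hy).2.trans (by omega)⟩⟩
    · exact ⟨0, fun y hy => (h ⟨y, hy⟩).elim⟩
  choose a ha using hbase
  -- The path edge from `i` to `i + 1` is indexed by `i`; it is the image of an edge in some
  -- component, so `i` lies in that component's half-open interval.
  have hsub : Finset.range (ℓ - 1) ⊆
      Finset.univ.biUnion fun r => Finset.Ico (a r) (a r + compDiam G 0 r) := by
    intro i hi
    rw [Finset.mem_range] at hi
    have hadj : (SimpleGraph.pathGraph ℓ).Adj ⟨i, by omega⟩ ⟨i + 1, by omega⟩ := by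
      rw [SimpleGraph.pathGraph_adj]
      simp
    obtain ⟨-, x, y, hx, hy, hxy⟩ := (hf.adj_iff _ _).1 hadj
    have h1 := ha _ x rfl
    have h2 := ha _ y (rep_eq_rep_iff.2 hxy.symm.reachable)
    simp only [hx, hy] at h1 h2
    simp only [Finset.mem_biUnion, Finset.mem_univ, true_and, Finset.mem_Ico]
    exact ⟨rep G x, by omega, by omega⟩
  have := (Finset.card_le_card hsub).trans Finset.card_biUnion_le
  simp only [Finset.card_range, Nat.card_Ico, add_tsub_cancel_left] at this
  omega

/-- A vertex of the component represented by `r` from which some vertex has distance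
`compDiam G 0 r`. -/
theorem exists_peripheral_vertex (G : SimpleGraph (Fin n)) (r : Fin n) :
    ∃ t, (∃ s, rep G s = r) → rep G t = r ∧ compDiam G 0 r = ecc G t := by
  by_cases h : ∃ s, rep G s = r
  · obtain ⟨s, hs⟩ := h
    obtain ⟨t, ht, ht'⟩ := exists_ecc_add_eq_compDiam 0 hs
    exact ⟨t, fun _ => ⟨ht, ht'⟩⟩
  · exact ⟨r, fun h' => (h h').elim⟩

/-- The layers of a component are shifted by the diameters of the components with smaller
representatives. The last layer of one component thus shares its path vertex with the first layer of
the next, and the path edges are split among the components without overlap. -/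
theorem exists_isQuotientMap_path (hn : 0 < n) :
    ∃ f, IsQuotientMap G (SimpleGraph.pathGraph (1 + ∑ r, compDiam G 0 r)) f := by
  choose t ht using exists_peripheral_vertex G
  set off : ℕ → ℕ := fun i => ∑ r : Fin n with r.1 < i, compDiam G 0 r with hoff
  have hdist : ∀ x, G.dist (t (rep G x)) x ≤ compDiam G 0 (rep G x) := fun x => by
    rw [(ht _ ⟨x, rfl⟩).2]
    exact dist_le_ecc _ _
  have hle : ∀ r : Fin n, off r + compDiam G 0 r ≤ ∑ r, compDiam G 0 r := fun r => by
    rw [hoff]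
    dsimp only
    rw [← sum_filter_lt_succ, ← sum_filter_lt_card]
    exact sum_filter_lt_mono _ r.2
  have hedge : ∀ i < ∑ r, compDiam G 0 r, ∃ x y, G.Adj x y ∧ rep G x = rep G y ∧
      off (rep G x) + G.dist (t (rep G x)) x = i ∧
      off (rep G y) + G.dist (t (rep G y)) y = i + 1 := by
    intro i hi
    obtain ⟨r, h1, h2⟩ := exists_between_partial_sums _ hi
    have hr : ∃ s, rep G s = r := by
      by_contra! hr
      have := compDiam_le (G := G) (δ := 0) (r := r) (c := 0) fun s hs => (hr s hs).elim
      omega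
    obtain ⟨z, hz, hz'⟩ := exists_dist_eq_ecc (G := G) (t r)
    obtain ⟨h3, h4⟩ := ht r hr
    obtain ⟨y, hy, hy'⟩ := SimpleGraph.exists_reachable_dist_eq (d := i - off r + 1) hz' hz
      (by rw [← h4]; simp only [hoff]; omega)
    obtain ⟨x, hxy, hx⟩ := SimpleGraph.exists_adj_of_dist_eq_succ hy'
    have e1 : rep G y = r := h3 ▸ (rep_eq_rep_iff.2 hy).symm
    have e2 : rep G x = r := e1 ▸ rep_eq_rep_iff.2 hxy.reachable
    have : off r ≤ i := h1
    exact ⟨x, y, hxy, e2.trans e1.symm, by rw [e2, hx]; omega, by rw [e1, hy']; omega⟩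
  refine ⟨fun x => ⟨off (rep G x) + G.dist (t (rep G x)) x, ?_⟩, ?_, ?_⟩
  · have := hle (rep G x)
    have := hdist x
    omega
  · rintro ⟨i, hi⟩
    -- With sum zero the path has a single vertex and no edge to lift; surjectivity then needs a
    -- vertex of `G`.
    rcases Nat.eq_zero_or_pos (∑ r, compDiam G 0 r) with h0 | hpos
    · refine ⟨⟨0, hn⟩, Fin.ext ?_⟩
      have := hle (rep G ⟨0, hn⟩)
      have := hdist ⟨0, hn⟩
      dsimp only
      omega
    · cases i with
      | zero =>
        obtain ⟨x, y, -, -, hx, -⟩ := hedge 0 hpos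
        exact ⟨x, Fin.ext hx⟩
      | succ i =>
        obtain ⟨x, y, -, -, -, hy⟩ := hedge i (by omega)
        exact ⟨y, Fin.ext hy⟩
  · rintro ⟨i, hi⟩ ⟨j, hj⟩
    simp only [SimpleGraph.pathGraph_adj, ne_eq, Fin.mk.injEq]
    constructor
    · rintro (rfl | rfl)
      · obtain ⟨x, y, hxy, -, hx, hy⟩ := hedge i (by omega)
        exact ⟨by omega, x, y, hx, hy, hxy⟩
      · obtain ⟨x, y, hxy, -, hx, hy⟩ := hedge j (by omega)
        exact ⟨by omega, y, x, hy, hx, hxy.symm⟩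
    · rintro ⟨hij, x, y, rfl, rfl, hxy⟩
      have hr := rep_eq_rep_iff.2 hxy.reachable
      have h1 := hxy.dist_le_succ (t (rep G x))
      have h2 := hxy.symm.dist_le_succ (t (rep G x))
      rw [← hr] at hij ⊢
      omega

theorem isYesInstance_pathClass_iff {k : ℕ} :
    IsYesInstance pathClass G k ↔ 0 < n ∧ n ≤ k + (1 + ∑ r, compDiam G 0 r) := by
  rw [isYesInstance_iff, Nat.card_fin]
  constructor
  · rintro ⟨W, H, ⟨ℓ, hℓ, ⟨e⟩⟩, ⟨f, hf⟩, hc⟩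
    have hf' := (IsQuotientMap.of_iso e).comp hf
    rw [Nat.card_congr e.toEquiv, Nat.card_fin] at hc
    have := hf'.card_path_le
    obtain ⟨x, -⟩ := hf'.surjective ⟨0, hℓ⟩
    exact ⟨x.pos, by omega⟩
  · rintro ⟨hn, hc⟩
    exact ⟨_, _, ⟨_, by omega, ⟨.refl⟩⟩, exists_isQuotientMap_path hn, by rw [Nat.card_fin]; omega⟩

end

/-! ### Identification to linear forests -/

/-- The disjoint union of the paths with `ℓ i` vertices. -/
def pathUnion {ι : Type} (ℓ : ι → ℕ) : SimpleGraph (Σ i, Fin (ℓ i)) where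
  Adj x y := x.1 = y.1 ∧ (x.2.1 + 1 = y.2.1 ∨ y.2.1 + 1 = x.2.1)
  symm.symm _ _ h := ⟨h.1.symm, h.2.symm⟩
  loopless.irrefl x h := by omega

theorem pathUnion_reachable_iff {ι : Type} {ℓ : ι → ℕ} {x y : Σ i, Fin (ℓ i)} :
    (pathUnion ℓ).Reachable x y ↔ x.1 = y.1 := by
  constructor
  · rintro ⟨p⟩
    induction p with
    | nil => rfl
    | cons h _ ih => exact h.1.trans ih
  · obtain ⟨i, x⟩ := x
    obtain ⟨j, y⟩ := y
    rintro rfl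
    exact (SimpleGraph.pathGraph_preconnected (ℓ i) x y).map
      (⟨fun a => ⟨i, a⟩, fun h => ⟨rfl, SimpleGraph.pathGraph_adj.1 h⟩⟩ :
        SimpleGraph.pathGraph (ℓ i) →g pathUnion ℓ)

theorem linearForestClass_pathUnion {ι : Type} [Finite ι] (ℓ : ι → ℕ) :
    linearForestClass _ (pathUnion ℓ) := by
  refine ⟨inferInstance, fun c => ?_⟩
  induction c using SimpleGraph.ConnectedComponent.ind with
  | h x =>
    obtain ⟨i, x⟩ := x
    have hmem : ∀ y, y ∈ (pathUnion ℓ).connectedComponentMk ⟨i, x⟩ ↔ y.1 = i := fun y => by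
      rw [← SetLike.mem_coe]
      exact SimpleGraph.ConnectedComponent.eq.trans pathUnion_reachable_iff
    refine ⟨ℓ i, x.pos, ⟨SimpleGraph.Iso.symm ⟨⟨fun a => ⟨⟨i, a⟩, (hmem _).2 rfl⟩,
      fun y => Fin.cast (congrArg ℓ ((hmem _).1 y.2)) y.1.2, fun a => rfl, ?_⟩, ?_⟩⟩⟩
    · rintro ⟨⟨j, y⟩, hy⟩
      obtain rfl : j = i := (hmem _).1 hy
      rfl
    · intro a b
      rw [SimpleGraph.pathGraph_adj]
      exact ⟨fun h => h.2, fun h => ⟨rfl, h⟩⟩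

/-- A linear forest can be embedded, one component at a time, into the natural numbers. -/
theorem linearForestClass.exists_nat_map {W : Type} {H : SimpleGraph W}
    (hH : linearForestClass W H) (w : W) : ∃ g : W → ℕ,
      (∀ x y, H.Reachable w x → H.Reachable w y → g x = g y → x = y) ∧
      ∀ x y, H.Reachable w x → H.Adj x y → g y ≤ g x + 1 := by
  classical
  obtain ⟨ℓ, -, ⟨e⟩⟩ := hH.2 (H.connectedComponentMk w)
  have hmem : ∀ x, x ∈ H.connectedComponentMk w ↔ H.Reachable w x := fun x => by
    rw [← SetLike.mem_coe, SimpleGraph.reachable_comm]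
    exact SimpleGraph.ConnectedComponent.eq
  refine ⟨fun x => if h : x ∈ H.connectedComponentMk w then (e ⟨x, h⟩).1 else 0, ?_, ?_⟩
  · intro x y hx hy hxy
    rw [← hmem] at hx hy
    simp only [hx, hy, dite_true] at hxy
    simpa using e.injective (Fin.ext hxy)
  · intro x y hx hxy
    have hy := hx.trans hxy.reachable
    rw [← hmem] at hx hy
    simp only [hx, hy, dite_true]
    have : (SimpleGraph.pathGraph ℓ).Adj (e ⟨x, hx⟩) (e ⟨y, hy⟩) :=
      e.map_adj_iff.2 ((SimpleGraph.ConnectedComponent.toSimpleGraph_adj _ hx hy).2 hxy)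
    rw [SimpleGraph.pathGraph_adj] at this
    omega

section

variable {n : ℕ} {G : SimpleGraph (Fin n)}

/-- The image of a component of `G` is connected, so it lies in one path of `H`. The position along
that path is a Lipschitz coordinate, injective on the image, and takes at most diameter plus one
values. -/
theorem IsQuotientMap.card_linearForest_le {W : Type} {H : SimpleGraph W} {f : Fin n → W}
    (hf : IsQuotientMap G H f) (hH : linearForestClass W H) :
    Nat.card W ≤ ∑ r, compDiam G 1 r := by
  classical
  have := hH.1
  have := Fintype.ofFinite W
  have hsub : (Finset.univ : Finset W) ⊆
      Finset.univ.biUnion fun r => (Finset.univ.filter (rep G · = r)).image f := by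
    intro w _
    obtain ⟨x, rfl⟩ := hf.surjective w
    simp only [Finset.mem_biUnion, Finset.mem_univ, true_and, Finset.mem_image, Finset.mem_filter]
    exact ⟨_, x, rfl, rfl⟩
  rw [Nat.card_eq_fintype_card, ← Finset.card_univ]
  refine ((Finset.card_le_card hsub).trans Finset.card_biUnion_le).trans
    (Finset.sum_le_sum fun r _ => ?_)
  by_cases hr : ∃ s, rep G s = r
  · obtain ⟨s, hs⟩ := hr
    obtain ⟨g, hg1, hg2⟩ := hH.exists_nat_map (f s)
    have hreach : ∀ x, rep G x = r → H.Reachable (f s) (f x) := fun x hx =>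
      hf.reachable (rep_eq_rep_iff.1 (hs.trans hx.symm))
    obtain ⟨t, rfl, ht'⟩ := exists_base_vertex hs (F := fun x => g (f x)) fun x y hx hxy => by
      by_cases h : f x = f y
      · rw [h]; omega
      · exact hg2 _ _ (hreach x hx) ((hf.adj_iff _ _).2 ⟨h, x, y, rfl, rfl, hxy⟩)
    have := ecc_add_le_compDiam (G := G) 1 t
    refine le_trans (Finset.card_le_card_of_injOn
      (t := Finset.Icc (g (f t)) (g (f t) + ecc G t)) g ?_ ?_) ?_
    · rintro w hw
      simp only [Finset.coe_image, Finset.coe_filter, Finset.mem_univ, true_and, Set.mem_image,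
        Set.mem_ofPred_eq] at hw
      obtain ⟨x, hx, rfl⟩ := hw
      simpa using ht' x hx
    · rintro _ hw _ hw'
      simp only [Finset.coe_image, Finset.coe_filter, Finset.mem_univ, true_and, Set.mem_image,
        Set.mem_ofPred_eq] at hw hw'
      obtain ⟨x, hx, rfl⟩ := hw
      obtain ⟨y, hy, rfl⟩ := hw'
      exact hg1 _ _ (hreach x hx) (hreach y hy)
    · rw [Nat.card_Icc]
      omega
  · rw [Finset.filter_false_of_mem fun s _ hs => hr ⟨s, hs⟩]
    simp

/-- The fibres are the distance layers from a peripheral vertex of each component. An edge joins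
vertices in equal or consecutive layers of the same component. -/
theorem exists_isQuotientMap_pathUnion (G : SimpleGraph (Fin n)) :
    ∃ f, IsQuotientMap G (pathUnion (compDiam G 1)) f := by
  choose t ht using exists_peripheral_vertex G
  have hlt : ∀ x, G.dist (t (rep G x)) x < compDiam G 1 (rep G x) := fun x => by
    have := dist_le_ecc (G := G) (t (rep G x)) x
    rw [compDiam_one_of_rep rfl, (ht _ ⟨x, rfl⟩).2]
    omega
  set f : Fin n → Σ r, Fin (compDiam G 1 r) := fun x =>
    ⟨rep G x, ⟨G.dist (t (rep G x)) x, hlt x⟩⟩ with hf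
  have hext : ∀ x r (i : Fin (compDiam G 1 r)), rep G x = r → G.dist (t r) x = i.1 →
      f x = ⟨r, i⟩ := by
    rintro x _ ⟨i, hi⟩ rfl rfl
    rfl
  have hsurj : ∀ r (i : Fin (compDiam G 1 r)), ∃ x, rep G x = r ∧ G.dist (t r) x = i.1 := by
    intro r i
    have hr : ∃ s, rep G s = r := by
      by_contra! hr
      have := compDiam_le (G := G) (δ := 1) (r := r) (c := 0) fun s hs => (hr s hs).elim
      have := i.2
      omega
    obtain ⟨s, hs⟩ := hr
    obtain ⟨h3, h4⟩ := ht r ⟨s, hs⟩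
    obtain ⟨z, hz, hz'⟩ := exists_dist_eq_ecc (G := G) (t r)
    have h5 := i.2
    have h6 := compDiam_one_of_rep hs
    obtain ⟨x, hx, hx'⟩ := SimpleGraph.exists_reachable_dist_eq (d := i.1) hz' hz (by omega)
    exact ⟨x, h3 ▸ (rep_eq_rep_iff.2 hx).symm, hx'⟩
  have hedge : ∀ r (i j : Fin (compDiam G 1 r)), i.1 + 1 = j.1 →
      ∃ x y, f x = ⟨r, i⟩ ∧ f y = ⟨r, j⟩ ∧ G.Adj x y := by
    intro r i j hij
    obtain ⟨y, hy, hy'⟩ := hsurj r j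
    obtain ⟨x, hxy, hx⟩ := SimpleGraph.exists_adj_of_dist_eq_succ (hy'.trans hij.symm)
    exact ⟨x, y, hext x r i (hy ▸ rep_eq_rep_iff.2 hxy.reachable) hx, hext y r j hy hy', hxy⟩
  refine ⟨f, ?_, ?_⟩
  · rintro ⟨r, i⟩
    obtain ⟨x, hx, hx'⟩ := hsurj r i
    exact ⟨x, hext x r i hx hx'⟩
  · rintro ⟨r, i⟩ ⟨r', j⟩
    constructor
    · intro h
      refine ⟨h.ne, ?_⟩
      obtain ⟨h1, h2⟩ := h
      dsimp only at h1 h2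
      subst h1
      rcases h2 with h2 | h2
      · exact hedge r i j h2
      · obtain ⟨x, y, hx, hy, hxy⟩ := hedge r j i h2
        exact ⟨y, x, hy, hx, hxy.symm⟩
    · rintro ⟨hne, x, y, hx, hy, hxy⟩
      rw [← hx, ← hy] at hne ⊢
      have hr := rep_eq_rep_iff.2 hxy.reachable
      have h1 := hxy.dist_le_succ (t (rep G x))
      have h2 := hxy.symm.dist_le_succ (t (rep G x))
      have h3 : G.dist (t (rep G x)) x ≠ G.dist (t (rep G x)) y := fun h =>
        hne (hext x _ _ hr (by dsimp only; rw [← hr, h]))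
      refine ⟨hr, ?_⟩
      change G.dist (t (rep G x)) x + 1 = G.dist (t (rep G y)) y ∨
        G.dist (t (rep G y)) y + 1 = G.dist (t (rep G x)) x
      rw [← hr]
      omega

theorem isYesInstance_linearForestClass_iff {k : ℕ} :
    IsYesInstance linearForestClass G k ↔ n ≤ k + ∑ r, compDiam G 1 r := by
  rw [isYesInstance_iff, Nat.card_fin]
  constructor
  · rintro ⟨W, H, hH, ⟨f, hf⟩, hc⟩
    have := hf.card_linearForest_le hH
    omega
  · intro hc
    refine ⟨_, _, linearForestClass_pathUnion _, exists_isQuotientMap_pathUnion G, ?_⟩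
    rw [Nat.card_sigma]
    simp only [Nat.card_fin]
    omega

/-! ### Edgeless graphs -/

theorem compDiam_bot_zero (r : Fin n) : compDiam (⊥ : SimpleGraph (Fin n)) 0 r = 0 :=
  Nat.le_zero.1 <| compDiam_le fun s _ => by simp [ecc]

theorem one_le_compDiam_bot_one (r : Fin n) : 1 ≤ compDiam (⊥ : SimpleGraph (Fin n)) 1 r := by
  have h : rep (⊥ : SimpleGraph (Fin n)) r = r := by
    rw [rep_eq_iff]
    simp
  have := ecc_add_le_compDiam (G := (⊥ : SimpleGraph (Fin n))) 1 r
  rw [h] at this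
  omega

end

/-! ### A program logic with time credits -/

/-- The program `P`, started in the state `s` with `c` time credits, stops after at most `c` steps,
and the final state and the number of remaining credits satisfy `Q`. -/
def Runs (B : ℕ) (P : RamProgram) (s : RamState) (c : ℕ) (Q : RamState → ℕ → Prop) : Prop :=
  ∃ t s', RamExec B P s t s' ∧ t ≤ c ∧ Q s' (c - t)

/-- Execution of a list of programs one after the other. -/
def RamProgram.block : List RamProgram → RamProgram
  | [] => .skip
  | P :: Ps => .seq P (block Ps)

section

variable {B : ℕ} {s : RamState} {c : ℕ} {Q : RamState → ℕ → Prop}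

theorem Runs.mono {P : RamProgram} {Q' : RamState → ℕ → Prop} (h : Runs B P s c Q)
    (hQ : ∀ s c, Q s c → Q' s c) : Runs B P s c Q' := by
  obtain ⟨t, s', h1, h2, h3⟩ := h
  exact ⟨t, s', h1, h2, hQ _ _ h3⟩

theorem Runs.skip (h : 1 ≤ c ∧ Q s (c - 1)) : Runs B .skip s c Q :=
  ⟨1, s, .skip s, h⟩

theorem Runs.const {d x : ℕ} (h : x ≤ B ∧ 1 ≤ c ∧ Q (s.setReg d x) (c - 1)) :
    Runs B (.const d x) s c Q :=
  ⟨1, _, .const s d x h.1, h.2⟩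

theorem Runs.add {d a b : ℕ} (h : s.reg a + s.reg b ≤ B ∧ 1 ≤ c ∧
    Q (s.setReg d (s.reg a + s.reg b)) (c - 1)) : Runs B (.add d a b) s c Q :=
  ⟨1, _, .add s d a b h.1, h.2⟩

theorem Runs.sub {d a b : ℕ} (h : s.reg a - s.reg b ≤ B ∧ 1 ≤ c ∧
    Q (s.setReg d (s.reg a - s.reg b)) (c - 1)) : Runs B (.sub d a b) s c Q :=
  ⟨1, _, .sub s d a b h.1, h.2⟩

/-- Naming the loaded value `x` lets later states mention mathematical data instead of nested memory
look-ups. -/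
theorem Runs.load {d a : ℕ} (x : ℕ) (hx : s.mem (s.reg a) = x)
    (h : x ≤ B ∧ 1 ≤ c ∧ Q (s.setReg d x) (c - 1)) : Runs B (.load d a) s c Q := by
  subst hx
  exact ⟨1, _, .load s d a h.1, h.2⟩

theorem Runs.store {a b : ℕ} (h : 1 ≤ c ∧ Q (s.setMem (s.reg a) (s.reg b)) (c - 1)) :
    Runs B (.store a b) s c Q :=
  ⟨1, _, .store s a b, h⟩

theorem Runs.seq {P P' : RamProgram} (h : Runs B P s c fun s c => Runs B P' s c Q) :
    Runs B (.seq P P') s c Q := by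
  obtain ⟨t, s', h1, h2, t', s'', h3, h4, h5⟩ := h
  exact ⟨t + t', s'', .seq h1 h3, by omega, by rwa [← Nat.sub_sub]⟩

theorem Runs.block_nil (h : 1 ≤ c ∧ Q s (c - 1)) : Runs B (.block []) s c Q := .skip h

theorem Runs.block_cons {P : RamProgram} {Ps : List RamProgram}
    (h : Runs B P s c fun s c => Runs B (.block Ps) s c Q) : Runs B (.block (P :: Ps)) s c Q :=
  .seq h

theorem Runs.ifLt {P P' : RamProgram} {a b : ℕ} (hc : 1 ≤ c)
    (h : s.reg a < s.reg b → Runs B P s (c - 1) Q)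
    (h' : ¬ s.reg a < s.reg b → Runs B P' s (c - 1) Q) : Runs B (.ifLt a b P P') s c Q := by
  by_cases hab : s.reg a < s.reg b
  · obtain ⟨t, s', h1, h2, h3⟩ := h hab
    exact ⟨t + 1, s', .ifTrue hab h1, by omega, by rwa [add_comm, ← Nat.sub_sub]⟩
  · obtain ⟨t, s', h1, h2, h3⟩ := h' hab
    exact ⟨t + 1, s', .ifFalse hab h1, by omega, by rwa [add_comm, ← Nat.sub_sub]⟩

/-- The rule for loops. No variant is needed, as every iteration consumes a credit. -/
theorem Runs.whileLt {P : RamProgram} {a b : ℕ} (I : RamState → ℕ → Prop)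
    (hbody : ∀ s c, I s c → s.reg a < s.reg b → 1 ≤ c ∧ Runs B P s (c - 1) I)
    (hexit : ∀ s c, I s c → ¬ s.reg a < s.reg b → 1 ≤ c ∧ Q s (c - 1)) (h : I s c) :
    Runs B (.whileLt a b P) s c Q := by
  induction c using Nat.strong_induction_on generalizing s with
  | _ c ih =>
    by_cases hab : s.reg a < s.reg b
    · obtain ⟨h0, t, s', h1, h2, h3⟩ := hbody s c h hab
      obtain ⟨t', s'', h4, h5, h6⟩ := ih (c - 1 - t) (by omega) h3
      exact ⟨t + t' + 1, s'', .whileTrue hab h1 h4, by omega,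
        by rwa [show c - (t + t' + 1) = c - 1 - t - t' by omega]⟩
    · exact ⟨1, s, .whileFalse hab, hexit s c h hab⟩

end

@[simp]
theorem RamState.setReg_reg (s : RamState) (d x a : ℕ) :
    (s.setReg d x).reg a = if a = d then x else s.reg a := by
  simp [RamState.setReg, Function.update_apply]

@[simp]
theorem RamState.setReg_mem (s : RamState) (d x : ℕ) : (s.setReg d x).mem = s.mem := rfl

@[simp]
theorem RamState.setMem_reg (s : RamState) (p x : ℕ) : (s.setMem p x).reg = s.reg := rfl

@[simp]
theorem RamState.setMem_mem (s : RamState) (p x q : ℕ) :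
    (s.setMem p x).mem q = if q = p then x else s.mem q := by
  simp [RamState.setMem, Function.update_apply]

/-! ### The input words -/

section

variable {n : ℕ} (adj : Fin n → List (Fin n)) (k : ℕ)

theorem listAddress_zero : listAddress adj 0 = n + 3 := by
  simp [listAddress]

theorem listAddress_succ (v : Fin n) :
    listAddress adj (v + 1) = listAddress adj v + (adj v).length := by
  rw [listAddress, sum_filter_lt_succ, ← add_assoc, listAddress]

theorem listAddress_card : listAddress adj n = n + 3 + ∑ v, (adj v).length := by
  rw [listAddress, sum_filter_lt_card]

theorem listAddress_mono {v w : ℕ} (h : v ≤ w) : listAddress adj v ≤ listAddress adj w :=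
  Nat.add_le_add_left (sum_filter_lt_mono _ h) _

theorem inputWords_getD_zero : (inputWords adj k).getD 0 0 = n := rfl

theorem inputWords_getD_one : (inputWords adj k).getD 1 0 = k := rfl

theorem inputWords_getD_pointer {v : ℕ} (hv : v ≤ n) :
    (inputWords adj k).getD (v + 2) 0 = listAddress adj v := by
  rw [inputWords, List.getD_append _ _ _ _ (by simp; omega)]
  simp only [List.getD_cons_succ]
  rw [List.getD_eq_getElem _ _ (by simp; omega)]
  simp

theorem flatten_getElem?_sum {α : Type} (l : List (List α)) (v : ℕ) (hv : v < l.length) (i : ℕ)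
    (hi : i < l[v].length) :
    l.flatten[((l.take v).map List.length).sum + i]? = some l[v][i] := by
  have h : l.flatten = (l.take v).flatten ++ (l.drop v).flatten := by
    rw [← List.flatten_append, List.take_append_drop]
  rw [h, ← List.length_flatten, List.getElem?_append_right (by omega), add_tsub_cancel_left,
    List.drop_eq_getElem_cons hv, List.flatten_cons, List.getElem?_append_left hi,
    List.getElem?_eq_getElem hi]

theorem sum_take_ofFn_length {v : ℕ} (hv : v ≤ n) :
    (((List.ofFn adj).take v).map List.length).sum =
      ∑ u : Fin n with u.1 < v, (adj u).length := by
  induction v with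
  | zero => simp
  | succ v ih =>
    rw [sum_filter_lt_succ (fun u => (adj u).length) ⟨v, hv⟩, ← ih (by omega),
      List.take_succ_eq_append_getElem (by simpa using hv)]
    simp

theorem inputWords_getD_list (v : Fin n) (i : ℕ) (hi : i < (adj v).length) :
    (inputWords adj k).getD (listAddress adj v + i) 0 = ((adj v)[i]).1 := by
  have hlen : (n :: k :: (List.range (n + 1)).map (listAddress adj)).length = n + 3 := by simp
  rw [inputWords, List.getD_append_right _ _ _ _ (by rw [hlen, listAddress]; omega), hlen,
    listAddress, show n + 3 + _ + i - (n + 3) = (∑ u : Fin n with u.1 < v.1, (adj u).length) + i by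
      omega, List.getD_eq_getElem?_getD, List.getElem?_map, ← sum_take_ofFn_length adj v.2.le,
    flatten_getElem?_sum _ v.1 (by simp) i (by simpa using hi)]
  simp

theorem listAddress_add_lt (v : Fin n) {i : ℕ} (hi : i < (adj v).length) :
    listAddress adj v + i < listAddress adj n := by
  have h1 := listAddress_succ adj v
  have h2 := listAddress_mono adj (show v.1 + 1 ≤ n from v.2)
  omega

/-- The working arrays lie behind the input, so the distances and maxima start out as zero without
an initialisation loop. -/
theorem inputWords_getD_ge {i : ℕ} (hi : listAddress adj n ≤ i) :
    (inputWords adj k).getD i 0 = 0 := by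
  apply List.getD_eq_default
  have h1 := sum_take_ofFn_length adj le_rfl
  rw [List.take_of_length_le (by simp), sum_filter_lt_card] at h1
  have h2 := listAddress_card adj
  simp only [inputWords, List.length_append, List.length_cons, List.length_map, List.length_range,
    List.length_flatten]
  omega

end

section

variable {n : ℕ} {G : SimpleGraph (Fin n)} {adj : Fin n → List (Fin n)}

theorem IsAdjacencyList.sum_length (h : IsAdjacencyList G adj) :
    ∑ v, (adj v).length = 2 * G.edgeSet.ncard := by
  classical
  rw [Set.ncard_eq_toFinset_card', ← SimpleGraph.edgeFinset, ← G.sum_degrees_eq_twice_card_edges]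
  refine Finset.sum_congr rfl fun v _ => ?_
  rw [← SimpleGraph.card_neighborFinset_eq_degree, ← List.toFinset_card_of_nodup (h v).1]
  congr 1
  ext w
  simp [(h v).2 w]

end

/-! ### Breadth-first search -/

/-- The state of a breadth-first search from `s`: the vertices of `don` have been dequeued, those of
`rest` are queued, and `pend` holds the neighbours of the last dequeued vertex that have not been
looked at. Discovered vertices are those with `b ≤ D v`; their distance from `s` is `D v - b`.
Vertices that are discovered next get the value `d`, and `r` is the least dequeued vertex (or `s`). -/
structure BfsInv {n : ℕ} (G : SimpleGraph (Fin n)) (s : Fin n) (b : ℕ) (D : Fin n → ℕ)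
    (don rest pend : List (Fin n)) (d : ℕ) (r : Fin n) : Prop where
  nodup : (don ++ rest).Nodup
  source : s ∈ don ++ rest
  source_eq : D s = b
  mem_iff : ∀ v, v ∈ don ++ rest ↔ b ≤ D v
  walk : ∀ v ∈ don ++ rest, ∃ p : G.Walk s v, p.length + b = D v
  bound : ∀ v ∈ don ++ rest, D v + 1 ≤ b + (don ++ rest).length
  done_lt : ∀ x ∈ don, D x < d
  rest_le : ∀ x ∈ rest, D x ≤ d ∧ d ≤ D x + 1
  sorted : rest.Pairwise fun x y => D x ≤ D y
  closed : ∀ x ∈ don, ∀ w, G.Adj x w →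
    w ∈ don ++ rest ∧ D w ≤ D x + 1 ∨ w ∈ pend ∧ D x + 1 = d
  pend_adj : ∀ w ∈ pend, ∃ x ∈ don, D x + 1 = d ∧ G.Adj x w
  attained : don ≠ [] → ∃ x ∈ don, D x + 1 = d
  min_mem : r ∈ don ++ rest
  min_le : ∀ x ∈ don, r ≤ x

namespace BfsInv

variable {n : ℕ} {G : SimpleGraph (Fin n)} {s : Fin n} {b : ℕ} {D : Fin n → ℕ}
  {don rest pend : List (Fin n)} {d : ℕ} {r : Fin n}

/-- Entries left over from earlier searches lie below `b` and so read as undiscovered. -/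
theorem init (G : SimpleGraph (Fin n)) (s : Fin n) (hD : ∀ v, D v < b) :
    BfsInv G s b (Function.update D s b) [] [s] [] b s where
  nodup := by simp
  source := by simp
  source_eq := by simp
  mem_iff v := by
    by_cases h : v = s
    · simp [h]
    · simp [h, hD v]
  walk v hv := by
    obtain rfl : v = s := by simpa using hv
    exact ⟨.nil, by simp⟩
  bound v hv := by
    obtain rfl : v = s := by simpa using hv
    simp
  done_lt := by simp
  rest_le := by simp
  sorted := by simp
  closed := by simp
  pend_adj := by simp
  attained := by simp
  min_mem := by simp
  min_le := by simp

theorem visit {u : Fin n} {ws : List (Fin n)} (h : BfsInv G s b D don (u :: rest) [] d r)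
    (hws : ∀ w, w ∈ ws ↔ G.Adj u w) :
    BfsInv G s b D (don ++ [u]) rest ws (D u + 1) (if u < r then u else r) := by
  have happ : don ++ [u] ++ rest = don ++ u :: rest := by simp
  have hu := h.rest_le u (by simp)
  have hsorted := List.pairwise_cons.1 h.sorted
  refine ⟨happ ▸ h.nodup, happ ▸ h.source, h.source_eq, happ ▸ h.mem_iff, happ ▸ h.walk,
    happ ▸ h.bound, ?_, ?_, hsorted.2, ?_, ?_, ?_, ?_, ?_⟩
  · intro x hx
    rcases List.mem_append.1 hx with hx | hx
    · have := h.done_lt x hx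
      omega
    · obtain rfl : x = u := by simpa using hx
      omega
  · intro x hx
    have h1 := h.rest_le x (by simp [hx])
    have h2 := hsorted.1 x hx
    omega
  · intro x hx w hxw
    rw [happ]
    rcases List.mem_append.1 hx with hx | hx
    · rcases h.closed x hx w hxw with h1 | h1
      · exact Or.inl h1
      · simp at h1
    · obtain rfl : x = u := by simpa using hx
      exact Or.inr ⟨(hws w).2 hxw, rfl⟩
  · intro w hw
    exact ⟨u, by simp, rfl, (hws w).1 hw⟩
  · intro _
    exact ⟨u, by simp, rfl⟩
  · rw [happ]
    split_ifs
    · simp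
    · exact h.min_mem
  · intro x hx
    rcases List.mem_append.1 hx with hx | hx
    · have := h.min_le x hx
      split_ifs with h1
      · exact h1.le.trans this
      · exact this
    · obtain rfl : x = u := by simpa using hx
      split_ifs with h1
      · exact le_rfl
      · exact not_lt.1 h1

theorem le_of_mem (h : BfsInv G s b D don rest pend d r) {v : Fin n} (hv : v ∈ don ++ rest) :
    D v ≤ d := by
  rcases List.mem_append.1 hv with hv | hv
  · exact (h.done_lt v hv).le
  · exact (h.rest_le v hv).1

theorem scan_old {w : Fin n} {ws : List (Fin n)} (h : BfsInv G s b D don rest (w :: ws) d r)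
    (hw : b ≤ D w) : BfsInv G s b D don rest ws d r :=
  { h with
    closed := fun x hx y hxy => by
      rcases h.closed x hx y hxy with h1 | ⟨h1, h2⟩
      · exact Or.inl h1
      · rcases List.mem_cons.1 h1 with rfl | h1
        · have hy := (h.mem_iff y).2 hw
          exact Or.inl ⟨hy, by have := h.le_of_mem hy; omega⟩
        · exact Or.inr ⟨h1, h2⟩
    pend_adj := fun y hy => h.pend_adj y (by simp [hy]) }

/-- All queued values are at most `d`, so appending `w` with value `d` keeps the queue sorted. A
walk to `w` is obtained by extending the walk to a dequeued neighbour of value `d - 1`. -/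
theorem scan_new {w : Fin n} {ws : List (Fin n)} (h : BfsInv G s b D don rest (w :: ws) d r)
    (hw : D w < b) :
    BfsInv G s b (Function.update D w d) don (rest ++ [w]) ws d r := by
  have happ : don ++ (rest ++ [w]) = (don ++ rest) ++ [w] := by simp
  have hnot : w ∉ don ++ rest := fun hmem => by
    have := (h.mem_iff w).1 hmem
    omega
  have hD : ∀ x ∈ don ++ rest, Function.update D w d x = D x := fun x hx =>
    Function.update_of_ne (by rintro rfl; exact hnot hx) _ _
  have hDd : ∀ x ∈ don, Function.update D w d x = D x := fun x hx =>
    hD x (List.mem_append_left _ hx)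
  have hDr : ∀ x ∈ rest, Function.update D w d x = D x := fun x hx =>
    hD x (List.mem_append_right _ hx)
  obtain ⟨p, hp, hpd, hpw⟩ := h.pend_adj w (by simp)
  have hp' : p ∈ don ++ rest := List.mem_append_left _ hp
  have hdb := (h.mem_iff p).1 hp'
  refine ⟨?_, ?_, ?_, ?_, ?_, ?_, ?_, ?_, ?_, ?_, ?_, ?_, ?_, h.min_le⟩
  · rw [happ, List.nodup_append]
    refine ⟨h.nodup, by simp, ?_⟩
    intro x hx y hy
    obtain rfl : y = w := by simpa using hy
    exact fun hxy => hnot (hxy ▸ hx)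
  · rw [happ]
    exact List.mem_append_left _ h.source
  · rw [hD s h.source, h.source_eq]
  · intro v
    rw [happ]
    by_cases hvw : v = w
    · subst hvw
      simp
      omega
    · rw [Function.update_of_ne hvw, ← h.mem_iff]
      simp [hvw]
  · intro v hv
    rw [happ, List.mem_append] at hv
    rcases hv with hv | hv
    · rw [hD v hv]
      exact h.walk v hv
    · obtain rfl : v = w := by simpa using hv
      obtain ⟨q, hq⟩ := h.walk p hp'
      refine ⟨q.concat hpw, ?_⟩
      rw [SimpleGraph.Walk.length_concat, Function.update_self]
      omega
  · intro v hv
    rw [happ, List.mem_append] at hv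
    rw [happ, List.length_append, List.length_singleton]
    rcases hv with hv | hv
    · rw [hD v hv]
      have := h.bound v hv
      omega
    · obtain rfl : v = w := by simpa using hv
      have := h.bound p hp'
      rw [Function.update_self]
      omega
  · intro x hx
    rw [hDd x hx]
    exact h.done_lt x hx
  · intro x hx
    rcases List.mem_append.1 hx with hx | hx
    · rw [hDr x hx]
      exact h.rest_le x hx
    · obtain rfl : x = w := by simpa using hx
      simp
  · rw [List.pairwise_append]
    refine ⟨h.sorted.imp_of_mem fun hx hy hxy => by rwa [hDr _ hx, hDr _ hy], by simp, ?_⟩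
    intro x hx y hy
    obtain rfl : y = w := by simpa using hy
    rw [hDr x hx, Function.update_self]
    exact (h.rest_le x hx).1
  · intro x hx y hxy
    rw [hDd x hx, happ]
    by_cases hyw : y = w
    · subst hyw
      rw [Function.update_self]
      rcases h.closed x hx y hxy with h1 | h1
      · exact absurd h1.1 hnot
      · exact Or.inl ⟨by simp, h1.2.ge⟩
    · rw [Function.update_of_ne hyw]
      rcases h.closed x hx y hxy with h1 | ⟨h1, h2⟩
      · exact Or.inl ⟨List.mem_append_left _ h1.1, h1.2⟩
      · rcases List.mem_cons.1 h1 with h1 | h1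
        · exact absurd h1 hyw
        · exact Or.inr ⟨h1, h2⟩
  · intro y hy
    obtain ⟨x, hx, h1, h2⟩ := h.pend_adj y (by simp [hy])
    exact ⟨x, hx, by rw [hDd x hx]; exact h1, h2⟩
  · intro hne
    obtain ⟨x, hx, h1⟩ := h.attained hne
    exact ⟨x, hx, by rw [hDd x hx]; exact h1⟩
  · rw [happ]
    exact List.mem_append_left _ h.min_mem

theorem length_le (h : BfsInv G s b D don rest pend d r) : (don ++ rest).length ≤ n := by
  simpa using h.nodup.length_le_card

/-- Bounds the size of the numbers the machine handles during a search. -/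
theorem lt_add_card (h : BfsInv G s b D don rest pend d r) (v : Fin n) : D v < b + n := by
  by_cases hv : v ∈ don ++ rest
  · have h1 := h.bound v hv
    have h2 := h.length_le
    omega
  · have := mt (h.mem_iff v).2 hv
    omega

theorem done_ne_nil (h : BfsInv G s b D don [] [] d r) : don ≠ [] := by
  rintro rfl
  simpa using h.source

theorem le_add_card (h : BfsInv G s b D don rest pend d r) (hne : don ≠ []) : d ≤ b + n := by
  obtain ⟨x, hx, hxd⟩ := h.attained hne
  have h1 := h.bound x (List.mem_append_left _ hx)
  have h2 := h.length_le
  omega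

/-- This makes the final `d` a valid base for the next search. -/
theorem lt_of_finished (h : BfsInv G s b D don [] [] d r) (v : Fin n) : D v < d := by
  by_cases hv : v ∈ don
  · exact h.done_lt v hv
  · obtain ⟨x, hx, hxd⟩ := h.attained h.done_ne_nil
    have h1 := (h.mem_iff x).1 (by simpa using hx)
    have h2 := mt (h.mem_iff v).2 (by simpa using hv)
    omega

theorem mem_don_iff (h : BfsInv G s b D don [] [] d r) {v : Fin n} :
    v ∈ don ↔ G.Reachable s v := by
  constructor
  · intro hv
    obtain ⟨p, -⟩ := h.walk v (by simpa using hv)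
    exact ⟨p⟩
  · rintro ⟨p⟩
    have hadj : ∀ x y, G.Adj x y → x ∈ don → y ∈ don := fun x y hxy hx => by
      simpa using (h.closed x hx y hxy).resolve_right (by simp) |>.1
    have hs : s ∈ don := by simpa using h.source
    clear h
    induction p with
    | nil => exact hs
    | cons hab p ih => exact ih (hadj _ _ hab hs)

/-- The recorded walks give `dist ≤ D - b`, and closure under edges makes `D` Lipschitz, which gives
the converse. So `D - b` is the distance on the component, and `d` exceeds the largest value by one.
-/
theorem eq_add_ecc (h : BfsInv G s b D don [] [] d r) : d = b + ecc G s + 1 := by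
  classical
  have hadj : ∀ x y, G.Adj x y → x ∈ don → y ∈ don ∧ D y ≤ D x + 1 := fun x y hxy hx => by
    simpa using h.closed x hx y hxy
  have hdist : ∀ v ∈ don, D v = b + G.dist s v := fun v hv => by
    obtain ⟨p, hp⟩ := h.walk v (by simpa using hv)
    have h1 := SimpleGraph.dist_le p
    have h2 := (h.mem_don_iff.1 hv).le_add_dist (F := fun x => if x ∈ don then D x else 0)
      fun x y hxy => by
        by_cases hx : x ∈ don
        · simp only [hx, (hadj x y hxy hx).1, if_true]
          exact (hadj x y hxy hx).2
        · have hy : y ∉ don := fun hy => hx (hadj y x hxy.symm hy).1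
          simp [hx, hy]
    have hs : s ∈ don := by simpa using h.source
    simp only [hs, hv, if_true, h.source_eq] at h2
    omega
  obtain ⟨x, hx, hxd⟩ := h.attained h.done_ne_nil
  obtain ⟨z, hz, hz'⟩ := exists_dist_eq_ecc (G := G) s
  have h1 := hdist x hx
  have h2 := hdist z (h.mem_don_iff.2 hz)
  have h3 := dist_le_ecc (G := G) s x
  have h4 := h.lt_of_finished z
  omega

theorem eq_rep (h : BfsInv G s b D don [] [] d r) : rep G s = r :=
  rep_eq_iff.2 ⟨h.mem_don_iff.1 (by simpa using h.min_mem),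
    fun x hx => h.min_le x (h.mem_don_iff.2 hx)⟩

end BfsInv

/-! ### The program -/

section

open RamProgram

/-- Look at one entry `w` of the adjacency list of the current vertex, and append `w` to the queue
if it has not been discovered yet. Registers: `14` address of the entry, `5` first address of the
array of distances, `9` least distance value of the current search, `12` tail of the queue, `13`
distance value of newly discovered vertices. -/
def scanProgram : RamProgram :=
  block [.load 16 14, .add 14 14 4, .add 17 5 16, .load 18 17,
    .ifLt 18 9 (block [.store 17 13, .store 12 16, .add 12 12 4]) .skip]

/-- Dequeue a vertex `u`: set register `13` to its distance value plus one, the registers `14` and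
`15` to the beginning and the end of its adjacency list, and register `19` to the least dequeued
vertex. -/
def visitProgram : RamProgram :=
  block [.load 16 11, .add 11 11 4, .add 17 5 16, .load 13 17, .add 13 13 4, .const 17 2,
    .add 17 17 16, .load 14 17, .add 17 17 4, .load 15 17, .ifLt 16 19 (.add 19 16 3) .skip]

/-- Breadth-first search, with the queue between the addresses in the registers `11` and `12`. -/
def bfsProgram : RamProgram :=
  .whileLt 11 12 (.seq visitProgram (.whileLt 14 15 scanProgram))

/-- Prepare the search from the vertex in register `8`. -/
def startProgram : RamProgram :=
  block [.add 17 5 8, .store 17 9, .store 6 8, .add 11 6 3, .add 12 6 4, .add 13 9 3, .add 19 8 3]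

/-- After a search, update the maximum of the component and the sum in register `10` of the maxima,
and go to the next source vertex. -/
def finishProgram : RamProgram :=
  block [.sub 20 13 9, .sub 20 20 21, .add 9 13 3, .add 17 7 19, .load 18 17,
    .ifLt 18 20 (block [.sub 16 20 18, .add 10 10 16, .store 17 20]) .skip, .add 8 8 4]

/-- Search from all vertices. -/
def searchProgram : RamProgram :=
  .whileLt 8 1 (.seq startProgram (.seq bfsProgram finishProgram))

/-- Compute the largest number of vertices of a path (`ε = 1`) or of a linear forest (`ε = 0`) that
the input graph can be transformed into, and compare it with `n - k`. The program `E` treats graphs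
without edges. -/
def identificationProgram (ε : ℕ) (E : RamProgram) : RamProgram :=
  .seq (block [.load 1 3, .const 4 1, .load 2 4, .const 17 2, .load 18 17, .add 17 17 1,
      .load 5 17])
    (.ifLt 18 5
      (.seq (block [.add 6 5 1, .add 7 6 1, .const 9 1, .const 10 ε, .const 21 ε])
        (.seq searchProgram (block [.add 17 2 10, .ifLt 17 1 (.const 0 0) (.const 0 1)])))
      E)

end

/-! ### Correctness of the program -/

/-- The registers that stay constant during the searches, and the input part of the memory. -/
structure Layout {n : ℕ} (adj : Fin n → List (Fin n)) (k ε : ℕ) (s : RamState) : Prop where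
  reg_card : s.reg 1 = n
  reg_k : s.reg 2 = k
  reg_zero : s.reg 3 = 0
  reg_one : s.reg 4 = 1
  reg_dist : s.reg 5 = listAddress adj n
  reg_queue : s.reg 6 = listAddress adj n + n
  reg_max : s.reg 7 = listAddress adj n + n + n
  reg_eps : s.reg 21 = ε
  input : ∀ i < listAddress adj n, s.mem i = (inputWords adj k).getD i 0

/-- Frame rule: the search programs write only to other registers and to addresses behind the input.
-/
theorem Layout.of_eq {n : ℕ} {adj : Fin n → List (Fin n)} {k ε : ℕ} {s s' : RamState}
    (h : Layout adj k ε s) (hr : ∀ i, i < 8 ∨ i = 21 → s'.reg i = s.reg i)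
    (hm : ∀ i < listAddress adj n, s'.mem i = s.mem i) : Layout adj k ε s' where
  reg_card := by rw [hr _ (by omega), h.reg_card]
  reg_k := by rw [hr _ (by omega), h.reg_k]
  reg_zero := by rw [hr _ (by omega), h.reg_zero]
  reg_one := by rw [hr _ (by omega), h.reg_one]
  reg_dist := by rw [hr _ (by omega), h.reg_dist]
  reg_queue := by rw [hr _ (by omega), h.reg_queue]
  reg_max := by rw [hr _ (by omega), h.reg_max]
  reg_eps := by rw [hr _ (by omega), h.reg_eps]
  input i hi := by rw [hm i hi, h.input i hi]

/-- The registers and the arrays during the search from the vertex `v`. -/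
structure BfsState {n : ℕ} (adj : Fin n → List (Fin n)) (k ε v b tot : ℕ) (M D : Fin n → ℕ)
    (don rest : List (Fin n)) (d : ℕ) (r : Fin n) (s : RamState) : Prop where
  layout : Layout adj k ε s
  reg_source : s.reg 8 = v
  reg_base : s.reg 9 = b
  reg_total : s.reg 10 = tot
  reg_head : s.reg 11 = listAddress adj n + n + don.length
  reg_tail : s.reg 12 = listAddress adj n + n + (don ++ rest).length
  reg_d : s.reg 13 = d
  reg_min : s.reg 19 = r.1
  mem_dist : ∀ x : Fin n, s.mem (listAddress adj n + x.1) = D x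
  mem_queue : ∀ i (h : i < (don ++ rest).length),
    s.mem (listAddress adj n + n + i) = ((don ++ rest)[i]).1
  mem_max : ∀ x : Fin n, s.mem (listAddress adj n + n + n + x.1) = M x

section

variable {n : ℕ} {G : SimpleGraph (Fin n)} {adj : Fin n → List (Fin n)} {k ε v b tot : ℕ}
  {M D : Fin n → ℕ} {don rest pend : List (Fin n)} {d : ℕ} {r : Fin n} {s : RamState} {B c : ℕ}

theorem runs_scanProgram {x u w : Fin n} {ws : List (Fin n)} {i : ℕ}
    (hB : listAddress adj n + n + n ≤ B) (hb : b + n ≤ B)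
    (hi : (adj u).drop i = w :: ws)
    (hs : BfsState adj k ε v b tot M D don rest d r s)
    (hI : BfsInv G x b D don rest (w :: ws) d r)
    (h14 : s.reg 14 = listAddress adj u + i) (hc : 10 ≤ c) :
    Runs B scanProgram s c fun s' c' => c ≤ c' + 10 ∧ s'.reg 15 = s.reg 15 ∧
      s'.reg 14 = listAddress adj u + (i + 1) ∧ ∃ D' rest', rest'.length ≤ rest.length + 1 ∧
      BfsInv G x b D' don rest' ws d r ∧ BfsState adj k ε v b tot M D' don rest' d r s' := by
  have hlen : i < (adj u).length := by
    by_contra hlt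
    rw [List.drop_eq_nil_of_le (by omega)] at hi
    simp at hi
  have hw : (adj u)[i] = w := by
    rw [List.drop_eq_getElem_cons hlen] at hi
    exact (List.cons.inj hi).1
  have haddr := listAddress_add_lt adj u hlen
  have hload : s.mem (listAddress adj u + i) = w.1 := by
    rw [hs.layout.input _ haddr, inputWords_getD_list _ _ _ _ hlen, hw]
  have hDw := hI.lt_add_card w
  have hwn := w.2
  have hqlen := hI.length_le
  unfold scanProgram
  refine .block_cons (.load w.1 (by rw [h14, hload]) ⟨by omega, by omega, ?_⟩)
  refine .block_cons (.add ⟨?_, by omega, ?_⟩)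
  · simp [h14, hs.layout.reg_one]; omega
  refine .block_cons (.add ⟨?_, by omega, ?_⟩)
  · simp [hs.layout.reg_dist]; omega
  refine .block_cons (.load (D w) ?_ ⟨by omega, by omega, ?_⟩)
  · simp [hs.layout.reg_dist, hs.mem_dist]
  refine .block_cons (.ifLt (by omega) (fun hlt => ?_) fun hlt => ?_)
  · simp [hs.reg_base] at hlt
    have hI' := hI.scan_new hlt
    have hqlen' := hI'.length_le
    simp only [List.length_append, List.length_singleton] at hqlen'
    refine .block_cons (.store ⟨by omega, ?_⟩)
    refine .block_cons (.store ⟨by omega, ?_⟩)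
    refine .block_cons (.add ⟨?_, by omega, ?_⟩)
    · simp [hs.reg_tail, hs.layout.reg_one]; omega
    refine .block_nil ⟨by omega, .block_nil ⟨by omega, by omega, ?_, ?_, _, _, ?_, hI', ?_⟩⟩
    · simp
    · simp [h14, hs.layout.reg_one]; omega
    · simp
    · constructor
      · refine hs.layout.of_eq ?_ ?_
        · intro j hj
          have : j ≠ 12 ∧ j ≠ 14 ∧ j ≠ 16 ∧ j ≠ 17 ∧ j ≠ 18 := by omega
          simp [this]
        · intro j hj
          simp [hs.layout.reg_dist, hs.reg_tail]
          rw [if_neg (by omega), if_neg (by omega)]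
      · simp [hs.reg_source]
      · simp [hs.reg_base]
      · simp [hs.reg_total]
      · simp [hs.reg_head]
      · simp [hs.reg_tail, hs.layout.reg_one]; omega
      · simp [hs.reg_d]
      · simp [hs.reg_min]
      · intro y
        simp [hs.reg_tail, hs.layout.reg_dist, hs.mem_dist, Function.update_apply, hs.reg_d]
        rw [if_neg (by have := y.2; omega)]
        simp only [Fin.ext_iff]
      · intro j hj
        simp [hs.reg_tail, hs.layout.reg_dist]
        rw [List.length_append, List.length_append, List.length_singleton] at hj
        by_cases hje : j = don.length + rest.length
        · simp [hje]
        · have hjl : j < (don ++ rest).length := by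
            rw [List.length_append]
            omega
          have happ : (don ++ (rest ++ [w]))[j] = (don ++ rest)[j] := by
            simp only [← List.append_assoc]
            rw [List.getElem_append_left]
          rw [if_neg hje, if_neg (by omega), hs.mem_queue j hjl, happ]
      · intro y
        simp [hs.reg_tail, hs.layout.reg_dist, hs.mem_max]
        rw [if_neg (by omega), if_neg (by omega)]
  · simp [hs.reg_base] at hlt
    refine .skip ⟨by omega, .block_nil ⟨by omega, by omega, ?_, ?_, D, rest, by omega,
      hI.scan_old hlt, ?_⟩⟩
    · simp
    · simp [h14, hs.layout.reg_one]; omega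
    · constructor
      · refine hs.layout.of_eq ?_ fun _ _ => rfl
        intro j hj
        have : j ≠ 14 ∧ j ≠ 16 ∧ j ≠ 17 ∧ j ≠ 18 := by omega
        simp [this]
      · simp [hs.reg_source]
      · simp [hs.reg_base]
      · simp [hs.reg_total]
      · simp [hs.reg_head]
      · simp [hs.reg_tail]
      · simp [hs.reg_d]
      · simp [hs.reg_min]
      · simpa using hs.mem_dist
      · simpa using hs.mem_queue
      · simpa using hs.mem_max

theorem runs_visitProgram {x u : Fin n} (hB : listAddress adj n + n + n ≤ B) (hb : b + n ≤ B)
    (hs : BfsState adj k ε v b tot M D don (u :: rest) d r s)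
    (hI : BfsInv G x b D don (u :: rest) [] d r) (hc : 20 ≤ c) :
    Runs B visitProgram s c fun s' c' => c ≤ c' + 20 ∧ s'.reg 14 = listAddress adj u ∧
      s'.reg 15 = listAddress adj (u + 1) ∧
      BfsState adj k ε v b tot M D (don ++ [u]) rest (D u + 1) (if u < r then u else r) s' := by
  have hu := u.2
  have hqlen := hI.length_le
  rw [List.length_append, List.length_cons] at hqlen
  have hload : s.mem (listAddress adj n + n + don.length) = u.1 := by
    rw [hs.mem_queue _ (by simp)]
    simp
  have hDu := hI.lt_add_card u
  have hL := listAddress_card adj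
  have hL0 := listAddress_mono adj hu.le
  have hL1 := listAddress_mono adj (show u.1 + 1 ≤ n from hu)
  unfold visitProgram
  refine .block_cons (.load u.1 (by rw [hs.reg_head, hload]) ⟨by omega, by omega, ?_⟩)
  refine .block_cons (.add ⟨?_, by omega, ?_⟩)
  · simp [hs.reg_head, hs.layout.reg_one]; omega
  refine .block_cons (.add ⟨?_, by omega, ?_⟩)
  · simp [hs.layout.reg_dist]; omega
  refine .block_cons (.load (D u) ?_ ⟨by omega, by omega, ?_⟩)
  · simp [hs.layout.reg_dist, hs.mem_dist]
  refine .block_cons (.add ⟨?_, by omega, ?_⟩)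
  · simp [hs.layout.reg_one]; omega
  refine .block_cons (.const ⟨by omega, by omega, ?_⟩)
  refine .block_cons (.add ⟨?_, by omega, ?_⟩)
  · simp; omega
  refine .block_cons (.load (listAddress adj u) ?_ ⟨by omega, by omega, ?_⟩)
  · simp [add_comm 2]
    rw [hs.layout.input _ (by omega), inputWords_getD_pointer _ _ hu.le]
  refine .block_cons (.add ⟨?_, by omega, ?_⟩)
  · simp [hs.layout.reg_one]; omega
  refine .block_cons (.load (listAddress adj (u + 1)) ?_ ⟨by omega, by omega, ?_⟩)
  · simp [hs.layout.reg_one]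
    rw [hs.layout.input _ (by omega), show 2 + u.1 + 1 = u.1 + 1 + 2 by omega,
      inputWords_getD_pointer _ _ hu]
  refine .block_cons (.ifLt (by omega) (fun hlt => .add ⟨?_, by omega, ?_⟩)
    fun hlt => .skip ⟨by omega, ?_⟩)
  · simp [hs.layout.reg_zero]; omega
  all_goals
    simp [hs.reg_min] at hlt
    refine .block_nil ⟨by omega, by omega, by simp, by simp, ?_⟩
    constructor
    · refine hs.layout.of_eq ?_ fun _ _ => rfl
      intro j hj
      have : j ≠ 11 ∧ j ≠ 13 ∧ j ≠ 14 ∧ j ≠ 15 ∧ j ≠ 16 ∧ j ≠ 17 ∧ j ≠ 19 := by omega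
      simp [this]
    · simp [hs.reg_source]
    · simp [hs.reg_base]
    · simp [hs.reg_total]
    · simp [hs.reg_head, hs.layout.reg_one]; omega
    · simp [hs.reg_tail]
    · simp [hs.layout.reg_one]
    · simp [hs.layout.reg_zero, hs.reg_min, hlt, not_lt.2]
    · simpa using hs.mem_dist
    · simpa using hs.mem_queue
    · simpa using hs.mem_max

theorem sum_map_le_of_nodup {l : List (Fin n)} (hl : l.Nodup) (f : Fin n → ℕ) :
    (l.map f).sum ≤ ∑ u, f u := by
  rw [← List.sum_toFinset _ hl]
  exact Finset.sum_le_sum_of_subset (Finset.subset_univ _)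

theorem runs_bfsProgram {x : Fin n} (hadj : IsAdjacencyList G adj)
    (hB : listAddress adj n + n + n ≤ B) (hb : b + n ≤ B)
    (hs : BfsState adj k ε v b tot M D [] [x] b x s) (hI : BfsInv G x b D [] [x] [] b x)
    {c' : ℕ} (hc : 40 * ∑ u, (adj u).length + 26 + c' ≤ c) :
    Runs B bfsProgram s c fun s c => c' ≤ c ∧ ∃ D don d r, BfsInv G x b D don [] [] d r ∧
      BfsState adj k ε v b tot M D don [] d r s := by
  -- Amortised cost: `X` counts the adjacency entries of vertices not yet dequeued, each worth 40
  -- credits, and each queued vertex holds 25. The 25 cover the 20 steps of a visit and the loop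
  -- tests; the 40 cover a test, the 10 steps of a scan and the 25 for a possible new queue member.
  refine .whileLt (fun s c => ∃ D don rest d r X, BfsInv G x b D don rest [] d r ∧
    BfsState adj k ε v b tot M D don rest d r s ∧
    X + (don.map fun u => (adj u).length).sum = ∑ u, (adj u).length ∧
    40 * X + 25 * rest.length + c' + 1 ≤ c) ?_ ?_ ?_
  · rintro s c ⟨D, don, rest, d, r, X, hI, hs, hX, hc⟩ hlt
    rw [hs.reg_head, hs.reg_tail, List.length_append] at hlt
    cases rest with
    | nil => simp at hlt
    | cons u rest =>
      rw [List.length_cons] at hc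
      refine ⟨by omega, .seq (.mono (runs_visitProgram hB hb hs hI (by omega)) ?_)⟩
      rintro s₁ c₁ ⟨hc₁, h14, h15, hs₁⟩
      have hI₁ := hI.visit (hadj u).2
      -- Dequeued vertices are distinct, so `X` is at least the degree of `u` and the truncated `X -
      -- i` below is a true difference.
      have hsum := sum_map_le_of_nodup hI₁.nodup.of_append_left fun u => (adj u).length
      simp only [List.map_append, List.sum_append, List.map_cons, List.map_nil, List.sum_cons,
        List.sum_nil, add_zero] at hsum
      generalize (if u < r then u else r) = r₁, D u + 1 = d₁ at hs₁ hI₁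
      refine .whileLt (fun s c => ∃ D rest i, BfsInv G x b D (don ++ [u]) rest ((adj u).drop i)
        d₁ r₁ ∧ BfsState adj k ε v b tot M D (don ++ [u]) rest d₁ r₁ s ∧
        s.reg 14 = listAddress adj u + i ∧ s.reg 15 = listAddress adj (u + 1) ∧
        i ≤ (adj u).length ∧ 40 * (X - i) + 25 * rest.length + c' + 2 ≤ c) ?_ ?_ ?_
      · rintro s c ⟨D', rest', i, hI', hs', h14, h15, hi, hc'⟩ hlt
        have hi' : i < (adj u).length := by
          rw [h14, h15, listAddress_succ] at hlt
          omega
        have hdrop := List.drop_eq_getElem_cons hi'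
        rw [hdrop] at hI'
        refine ⟨by omega, .mono (runs_scanProgram hB hb hdrop hs' hI' h14 (by omega)) ?_⟩
        rintro s₂ c₂ ⟨hc₂, h15', h14', D₂, rest₂, hrest₂, hI₂, hs₂⟩
        exact ⟨D₂, rest₂, i + 1, hI₂, hs₂, h14', h15'.trans h15, hi', by omega⟩
      · rintro s c ⟨D', rest', i, hI', hs', h14, h15, hi, hc'⟩ hlt
        rw [h14, h15, listAddress_succ] at hlt
        rw [List.drop_eq_nil_of_le (by omega)] at hI'
        refine ⟨by omega, D', don ++ [u], rest', _, r₁, X - (adj u).length, hI', hs', ?_, ?_⟩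
        · simp only [List.map_append, List.sum_append, List.map_cons, List.map_nil, List.sum_cons,
            List.sum_nil, add_zero]
          omega
        · have : i = (adj u).length := by omega
          rw [← this]
          omega
      · exact ⟨D, rest, 0, hI₁, hs₁, h14, h15, by omega, by omega⟩
  · rintro s c ⟨D, don, rest, d, r, X, hI, hs, hX, hc⟩ hlt
    rw [hs.reg_head, hs.reg_tail, List.length_append] at hlt
    obtain rfl : rest = [] := List.length_eq_zero_iff.1 (by omega)
    exact ⟨by omega, by omega, D, don, d, r, hI, hs⟩
  · exact ⟨D, [], [x], b, x, ∑ u, (adj u).length, hI, hs, by simp, by simp; omega⟩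

end

/-- The registers and the arrays between two searches. -/
structure SearchState {n : ℕ} (adj : Fin n → List (Fin n)) (k ε v b tot : ℕ) (M D : Fin n → ℕ)
    (s : RamState) : Prop where
  layout : Layout adj k ε s
  reg_source : s.reg 8 = v
  reg_base : s.reg 9 = b
  reg_total : s.reg 10 = tot
  mem_dist : ∀ x : Fin n, s.mem (listAddress adj n + x.1) = D x
  mem_max : ∀ x : Fin n, s.mem (listAddress adj n + n + n + x.1) = M x

section

variable {n : ℕ} {G : SimpleGraph (Fin n)} {adj : Fin n → List (Fin n)} {k ε b tot : ℕ}
  {M D : Fin n → ℕ} {don : List (Fin n)} {d : ℕ} {r : Fin n} {s : RamState} {B c : ℕ}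

theorem runs_startProgram {x : Fin n} (hB : listAddress adj n + n + n ≤ B) (hb : b + n ≤ B)
    (hs : SearchState adj k ε x b tot M D s) (hc : 8 ≤ c) :
    Runs B startProgram s c fun s' c' => c ≤ c' + 8 ∧
      BfsState adj k ε x b tot M (Function.update D x b) [] [x] b x s' := by
  have hx := x.2
  unfold startProgram
  refine .block_cons (.add ⟨?_, by omega, ?_⟩)
  · simp [hs.layout.reg_dist, hs.reg_source]; omega
  refine .block_cons (.store ⟨by omega, ?_⟩)
  refine .block_cons (.store ⟨by omega, ?_⟩)
  refine .block_cons (.add ⟨?_, by omega, ?_⟩)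
  · simp [hs.layout.reg_queue, hs.layout.reg_zero]; omega
  refine .block_cons (.add ⟨?_, by omega, ?_⟩)
  · simp [hs.layout.reg_queue, hs.layout.reg_one]; omega
  refine .block_cons (.add ⟨?_, by omega, ?_⟩)
  · simp [hs.reg_base, hs.layout.reg_zero]; omega
  refine .block_cons (.add ⟨?_, by omega, ?_⟩)
  · simp [hs.reg_source, hs.layout.reg_zero]; omega
  refine .block_nil ⟨by omega, by omega, ?_⟩
  constructor
  · refine hs.layout.of_eq ?_ ?_
    · intro j hj
      have : j ≠ 11 ∧ j ≠ 12 ∧ j ≠ 13 ∧ j ≠ 17 ∧ j ≠ 19 := by omega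
      simp [this]
    · intro j hj
      simp [hs.layout.reg_dist, hs.layout.reg_queue]
      rw [if_neg (by omega), if_neg (by omega)]
  · simp [hs.reg_source]
  · simp [hs.reg_base]
  · simp [hs.reg_total]
  · simp [hs.layout.reg_queue, hs.layout.reg_zero]
  · simp [hs.layout.reg_queue, hs.layout.reg_one]
  · simp [hs.reg_base, hs.layout.reg_zero]
  · simp [hs.reg_source, hs.layout.reg_zero]
  · intro y
    have := y.2
    simp [hs.layout.reg_queue, hs.layout.reg_dist, hs.reg_base, hs.reg_source, hs.mem_dist,
      Function.update_apply, Fin.ext_iff]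
    omega
  · intro j hj
    obtain rfl : j = 0 := by simpa using hj
    simp [hs.layout.reg_queue, hs.reg_source]
  · intro y
    simp [hs.layout.reg_queue, hs.layout.reg_dist, hs.reg_source, hs.mem_max]
    rw [if_neg (by omega), if_neg (by omega)]

/-- The total grows exactly as the recorded maximum does. Truncated subtraction makes the increment
zero when the maximum is not improved. -/
theorem runs_finishProgram {x : Fin n} {e : ℕ} (hB : listAddress adj n + n + n + n ≤ B)
    (hd : d ≤ B) (he : e = d - b - ε) (htot : tot + e ≤ B) (hM : M r ≤ B)
    (hs : BfsState adj k ε x b tot M D don [] d r s) (hc : 13 ≤ c) :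
    Runs B finishProgram s c fun s' c' => c ≤ c' + 13 ∧
      SearchState adj k ε (x + 1) d (tot + (e - M r)) (Function.update M r (max (M r) e)) D s' := by
  have hx := x.2
  have hr := r.2
  unfold finishProgram
  refine .block_cons (.sub ⟨?_, by omega, ?_⟩)
  · simp [hs.reg_d, hs.reg_base]; omega
  refine .block_cons (.sub ⟨?_, by omega, ?_⟩)
  · simp [hs.reg_d, hs.reg_base, hs.layout.reg_eps]; omega
  refine .block_cons (.add ⟨?_, by omega, ?_⟩)
  · simp [hs.reg_d, hs.layout.reg_zero]; omega
  refine .block_cons (.add ⟨?_, by omega, ?_⟩)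
  · simp [hs.layout.reg_max, hs.reg_min]; omega
  refine .block_cons (.load (M r) ?_ ⟨by omega, by omega, ?_⟩)
  · simp [hs.layout.reg_max, hs.reg_min, hs.mem_max]
  refine .block_cons (.ifLt (by omega) (fun hlt => ?_) fun hlt => ?_)
  · simp [hs.reg_d, hs.reg_base, hs.layout.reg_eps, ← he] at hlt
    refine .block_cons (.sub ⟨?_, by omega, ?_⟩)
    · simp [hs.reg_d, hs.reg_base, hs.layout.reg_eps, ← he]; omega
    refine .block_cons (.add ⟨?_, by omega, ?_⟩)
    · simp [hs.reg_d, hs.reg_base, hs.layout.reg_eps, hs.reg_total, ← he]; omega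
    refine .block_cons (.store ⟨by omega, ?_⟩)
    refine .block_nil ⟨by omega, .block_cons (.add ⟨?_, by omega, ?_⟩)⟩
    · simp [hs.reg_source, hs.layout.reg_one]; omega
    refine .block_nil ⟨by omega, by omega, ?_⟩
    constructor
    · refine hs.layout.of_eq ?_ ?_
      · intro j hj
        have : j ≠ 8 ∧ j ≠ 9 ∧ j ≠ 10 ∧ j ≠ 16 ∧ j ≠ 17 ∧ j ≠ 18 ∧ j ≠ 20 := by omega
        simp [this]
      · intro j hj
        simp [hs.layout.reg_max]
        omega
    · simp [hs.reg_source, hs.layout.reg_one]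
    · simp [hs.reg_d, hs.layout.reg_zero]
    · simp [hs.reg_d, hs.reg_base, hs.layout.reg_eps, hs.reg_total, ← he]
    · intro y
      have := y.2
      simp [hs.layout.reg_max, hs.mem_dist]
      omega
    · intro y
      simp [hs.layout.reg_max, hs.mem_max, hs.reg_min, hs.reg_d, hs.reg_base,
        hs.layout.reg_eps, ← he, Function.update_apply, Fin.ext_iff, max_eq_right hlt.le]
  · simp [hs.reg_d, hs.reg_base, hs.layout.reg_eps, ← he] at hlt
    refine .skip ⟨by omega, .block_cons (.add ⟨?_, by omega, ?_⟩)⟩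
    · simp [hs.reg_source, hs.layout.reg_one]; omega
    refine .block_nil ⟨by omega, by omega, ?_⟩
    rw [max_eq_left hlt, Function.update_eq_self, Nat.sub_eq_zero_of_le hlt]
    constructor
    · refine hs.layout.of_eq ?_ fun _ _ => rfl
      intro j hj
      have : j ≠ 8 ∧ j ≠ 9 ∧ j ≠ 17 ∧ j ≠ 18 ∧ j ≠ 20 := by omega
      simp [this]
    · simp [hs.reg_source, hs.layout.reg_one]
    · simp [hs.reg_d, hs.layout.reg_zero]
    · simp [hs.reg_total]
    · simpa using hs.mem_dist
    · simpa using hs.mem_max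

/-- The maximum of `ecc y + δ` over the vertices `y < v` of the component represented by `r`. -/
noncomputable def partialDiam (G : SimpleGraph (Fin n)) (δ v : ℕ) (r : Fin n) : ℕ :=
  (Finset.univ.filter fun y : Fin n => y.1 < v ∧ rep G y = r).sup fun y => ecc G y + δ

theorem partialDiam_zero (δ : ℕ) (r : Fin n) : partialDiam G δ 0 r = 0 := by
  simp [partialDiam]

theorem partialDiam_card (δ : ℕ) (r : Fin n) : partialDiam G δ n r = compDiam G δ r := by
  simp [partialDiam, compDiam]

/-- A new source affects only the entry of its own component, matching the single array update of
the machine. -/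
theorem partialDiam_succ (δ : ℕ) (x : Fin n) :
    partialDiam G δ (x + 1) = Function.update (partialDiam G δ x) (rep G x)
      (max (partialDiam G δ x (rep G x)) (ecc G x + δ)) := by
  funext r
  rw [Function.update_apply]
  split_ifs with h
  · subst h
    have : (Finset.univ.filter fun y : Fin n => y.1 < x.1 + 1 ∧ rep G y = rep G x) =
        insert x (Finset.univ.filter fun y : Fin n => y.1 < x.1 ∧ rep G y = rep G x) := by
      ext y
      simp only [Finset.mem_filter, Finset.mem_univ, true_and, Finset.mem_insert, Fin.ext_iff]
      constructor
      · rintro ⟨h1, h2⟩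
        omega
      · rintro (h1 | ⟨h1, h2⟩)
        · obtain rfl := Fin.ext h1
          exact ⟨by omega, rfl⟩
        · exact ⟨by omega, h2⟩
    rw [partialDiam, this, Finset.sup_insert, sup_comm]
    rfl
  · unfold partialDiam
    congr 1
    ext y
    simp only [Finset.mem_filter, Finset.mem_univ, true_and, Nat.lt_succ_iff_lt_or_eq]
    constructor
    · rintro ⟨h1 | h1, h2⟩
      · exact ⟨h1, h2⟩
      · obtain rfl := Fin.ext h1
        exact absurd h2.symm h
    · rintro ⟨h1, h2⟩
      exact ⟨Or.inl h1, h2⟩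

theorem ecc_lt (x : Fin n) : ecc G x < n := by
  obtain ⟨v, hv, hv'⟩ := exists_dist_eq_ecc (G := G) x
  obtain ⟨p, hp, hp'⟩ := hv.exists_path_of_dist
  have := hp.length_lt
  rw [Fintype.card_fin] at this
  omega

theorem partialDiam_le {δ : ℕ} (hδ : δ ≤ 1) (v : ℕ) (r : Fin n) : partialDiam G δ v r ≤ n :=
  Finset.sup_le fun y _ => by
    have := ecc_lt (G := G) y
    omega

theorem sum_update_max (M : Fin n → ℕ) (r : Fin n) (e : ℕ) :
    ∑ x, Function.update M r (max (M r) e) x = (∑ x, M x) + (e - M r) := by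
  rw [Finset.sum_update_of_mem (Finset.mem_univ r), ← Finset.add_sum_erase _ M (Finset.mem_univ r),
    ← Finset.erase_eq]
  omega

theorem runs_searchProgram (hadj : IsAdjacencyList G adj) (hε : ε ≤ 1)
    (hB : listAddress adj n + n + n + n ≤ B) (hnB : n * n + n + 2 ≤ B)
    (hs : SearchState adj k ε 0 1 ε (fun _ => 0) (fun _ => 0) s) {c' : ℕ}
    (hc : n * (40 * ∑ u, (adj u).length + 50) + 1 + c' ≤ c) :
    Runs B searchProgram s c fun s c => c' ≤ c ∧ Layout adj k ε s ∧
      s.reg 10 = ε + ∑ r, compDiam G (1 - ε) r := by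
  -- Each search raises the base by at most `n`, which gives the quadratic bound on `b`. The 50
  -- credits per source cover the loop test, the preparation (8), the constant part of the search
  -- (26) and the final update (13).
  refine .whileLt (fun s c => ∃ v b D, v ≤ n ∧ SearchState adj k ε v b
    (ε + ∑ r, partialDiam G (1 - ε) v r) (partialDiam G (1 - ε) v) D s ∧ (∀ x, D x < b) ∧
    b ≤ 1 + v * n ∧ (n - v) * (40 * ∑ u, (adj u).length + 50) + 1 + c' ≤ c) ?_ ?_ ?_
  · rintro s c ⟨v, b, D, hv, hs, hD, hb, hc⟩ hlt
    rw [hs.reg_source, hs.layout.reg_card] at hlt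
    lift v to Fin n using hlt with x
    have hx := x.2
    have hvn : (x.1 + 1) * n ≤ n * n := Nat.mul_le_mul_right n hx
    rw [add_mul, one_mul] at hvn
    obtain ⟨a, ha⟩ : ∃ a, n - x.1 = a + 1 := ⟨n - x.1 - 1, by omega⟩
    rw [ha, add_mul, one_mul] at hc
    refine ⟨by omega, .seq (.mono (runs_startProgram (by omega) (by omega) hs (by omega)) ?_)⟩
    rintro s₁ c₁ ⟨hc₁, hs₁⟩
    refine .seq (.mono (runs_bfsProgram (c' := a * (40 * ∑ u, (adj u).length + 50) + 14 + c') hadj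
      (by omega) (by omega) hs₁ (.init G x hD) (by omega)) ?_)
    rintro s₂ c₂ ⟨hc₂, D₂, don, d, r, hI, hs₂⟩
    -- The machine's `d - b - ε` therefore equals the eccentricity plus `1 - ε`, the shift used in
    -- `partialDiam`.
    have hd := hI.eq_add_ecc
    have hd' := hI.le_add_card hI.done_ne_nil
    obtain rfl := hI.eq_rep
    have hsum : ∑ r, partialDiam G (1 - ε) x r + (ecc G x + (1 - ε) -
        partialDiam G (1 - ε) x (rep G x)) = ∑ r, partialDiam G (1 - ε) (x + 1) r := by
      rw [partialDiam_succ, sum_update_max]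
    have hbound : ∑ r, partialDiam G (1 - ε) x r ≤ n * n := by
      simpa using Finset.sum_le_card_nsmul Finset.univ (partialDiam G (1 - ε) x) n
        fun r _ => partialDiam_le (by omega) x r
    have hecc := ecc_lt (G := G) x
    have hle := partialDiam_le (G := G) (show 1 - ε ≤ 1 by omega) x (rep G x)
    refine .mono (runs_finishProgram (e := ecc G x + (1 - ε)) hB (by omega) (by omega) ?_ ?_ hs₂
      (by omega)) ?_
    · omega
    · omega
    rintro s₃ c₃ ⟨hc₃, hs₃⟩
    rw [add_assoc, hsum, ← partialDiam_succ] at hs₃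
    refine ⟨x + 1, d, D₂, hx, hs₃, hI.lt_of_finished, ?_, ?_⟩
    · rw [add_mul, one_mul]
      omega
    · rw [show n - (x.1 + 1) = a by omega]
      omega
  · rintro s c ⟨v, b, D, hv, hs, hD, hb, hc⟩ hlt
    rw [hs.reg_source, hs.layout.reg_card] at hlt
    obtain rfl : v = n := by omega
    refine ⟨by omega, by omega, hs.layout, ?_⟩
    simp only [hs.reg_total, partialDiam_card]
  · refine ⟨0, 1, fun _ => 0, by omega, ?_, by simp, by omega, by omega⟩
    have : partialDiam G (1 - ε) 0 = fun _ => 0 := funext (partialDiam_zero _)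
    simpa [this] using hs

end

/-! ### The complete program and its running time -/

section

variable {n : ℕ} {adj : Fin n → List (Fin n)} {k ε : ℕ} {B c : ℕ} {Q : RamState → ℕ → Prop}

theorem runs_identificationProgram {G : SimpleGraph (Fin n)} (hadj : IsAdjacencyList G adj)
    (hε : ε ≤ 1) {E : RamProgram} (hB : listAddress adj n + n + n + n ≤ B)
    (hnB : n * n + n + k + 2 ≤ B) (hc : 40 ≤ c)
    (hc' : G.edgeSet.ncard ≠ 0 → n * (80 * G.edgeSet.ncard + 50) + 40 ≤ c)
    (hpos : G.edgeSet.ncard ≠ 0 →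
      ∀ s c, s.reg 0 = (if n ≤ k + (ε + ∑ r, compDiam G (1 - ε) r) then 1 else 0) → Q s c)
    (hzero : G.edgeSet.ncard = 0 → ∀ s c, s.reg 1 = n → s.reg 2 = k → s.reg 3 = 0 →
      s.reg 4 = 1 → 10 ≤ c → Runs B E s c Q) :
    Runs B (identificationProgram ε E) (initialState (inputWords adj k)) c Q := by
  have hsum := hadj.sum_length
  have hL := listAddress_card adj
  have hmem : ∀ i, (initialState (inputWords adj k)).mem i = (inputWords adj k).getD i 0 :=
    fun i => rfl
  have hreg : ∀ i, (initialState (inputWords adj k)).reg i = 0 := fun i => rfl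
  generalize initialState (inputWords adj k) = s at hmem hreg
  unfold identificationProgram
  refine .seq (.block_cons (.load n ?_ ⟨by omega, by omega, ?_⟩))
  · rw [hreg, hmem, inputWords_getD_zero]
  refine .block_cons (.const ⟨by omega, by omega, ?_⟩)
  refine .block_cons (.load k ?_ ⟨by omega, by omega, ?_⟩)
  · simp only [RamState.setReg_mem, RamState.setReg_reg, if_true]
    rw [hmem, inputWords_getD_one]
  refine .block_cons (.const ⟨by omega, by omega, ?_⟩)
  refine .block_cons (.load (n + 3) ?_ ⟨by omega, by omega, ?_⟩)
  · simp only [RamState.setReg_mem, RamState.setReg_reg, if_true]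
    rw [hmem, ← listAddress_zero adj]
    exact inputWords_getD_pointer adj k (Nat.zero_le n)
  refine .block_cons (.add ⟨?_, by omega, ?_⟩)
  · simp; omega
  refine .block_cons (.load (listAddress adj n) ?_ ⟨by omega, by omega, ?_⟩)
  · simp only [RamState.setReg_mem, RamState.setReg_reg, if_true]
    simp [hmem, add_comm 2]
    rw [← List.getD_eq_getElem?_getD]
    exact inputWords_getD_pointer adj k le_rfl
  -- The lists begin at `n + 3` and end `2m` cells later, so comparing the two addresses detects an
  -- edge in constant time.
  refine .block_nil ⟨by omega, .ifLt (by omega) (fun hlt => ?_) fun hlt => ?_⟩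
  · simp [hL] at hlt
    refine .seq (.block_cons (.add ⟨?_, by omega, ?_⟩))
    · simp; omega
    refine .block_cons (.add ⟨?_, by omega, ?_⟩)
    · simp; omega
    refine .block_cons (.const ⟨by omega, by omega, ?_⟩)
    refine .block_cons (.const ⟨by omega, by omega, ?_⟩)
    refine .block_cons (.const ⟨by omega, by omega, ?_⟩)
    refine .block_nil ⟨by omega, .seq (.mono (runs_searchProgram (k := k) (c' := 10) hadj hε hB
      (by omega) ?_ ?_) ?_)⟩
    · constructor
      · constructor <;> simp [hreg, hmem]
      · simp [hreg]
      · simp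
      · simp
      · intro x
        simp only [RamState.setReg_mem]
        rw [hmem, inputWords_getD_ge _ _ (by omega)]
      · intro x
        simp only [RamState.setReg_mem]
        rw [hmem, inputWords_getD_ge _ _ (by omega)]
    · have := hc' (by omega)
      rw [hsum, ← mul_assoc, show 40 * 2 = 80 from rfl]
      omega
    rintro s c ⟨hc, hs, htot⟩
    have hbound : ∑ r, compDiam G (1 - ε) r ≤ n * n := by
      simpa using Finset.sum_le_card_nsmul Finset.univ (compDiam G (1 - ε)) n fun r _ => by
        rw [← partialDiam_card]
        exact partialDiam_le (by omega) n r
    refine .block_cons (.add ⟨?_, by omega, ?_⟩)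
    · rw [hs.reg_k, htot]; omega
    refine .block_cons (.ifLt (by omega) (fun hlt => ?_) fun hlt => ?_)
    all_goals
      refine .const ⟨by omega, by omega, .block_nil ⟨by omega, hpos (by omega) _ _ ?_⟩⟩
      simp [hs.reg_k, htot, hs.reg_card] at hlt
      simp [hlt]
  · simp [hL, hsum] at hlt
    exact hzero (by omega) _ _ (by simp) (by simp) (by simp [hreg]) (by simp) (by omega)

end

/-- If there is an edge then `n ≤ n * m`, which absorbs the overhead of `n` searches. Without edges
the budget does not depend on `n`, so `E` must decide from the registers alone. -/
theorem solvableInTime_of_compDiam {𝓗 : GraphClass} {ε : ℕ} {E : RamProgram} (hε : ε ≤ 1)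
    (hpos : ∀ (n : ℕ) (G : SimpleGraph (Fin n)) (k : ℕ), G.edgeSet.ncard ≠ 0 →
      (IsYesInstance 𝓗 G k ↔ n ≤ k + (ε + ∑ r, compDiam G (1 - ε) r)))
    (hzero : ∀ (n k B : ℕ) (s : RamState) (c : ℕ), s.reg 1 = n → s.reg 2 = k → s.reg 3 = 0 →
      s.reg 4 = 1 → n + k + 2 ≤ B → 10 ≤ c → Runs B E s c fun s _ =>
        (IsYesInstance 𝓗 (⊥ : SimpleGraph (Fin n)) k → s.reg 0 = 1) ∧
        (¬ IsYesInstance 𝓗 (⊥ : SimpleGraph (Fin n)) k → s.reg 0 = 0)) :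
    SolvableInTime 𝓗 fun n m => n * m + 1 := by
  -- The time is at most `n * (80 * m + 50) + 40`, and the numbers are quadratic in `N`; as factor
  -- and exponent, 200 is generous.
  refine ⟨identificationProgram ε E, 200, fun n G adj hadj k => ?_⟩
  set m := G.edgeSet.ncard with hm
  set N := n + m + k + 1 with hN
  have hpow : N * N ≤ N ^ 200 := by
    rw [← pow_two]
    exact Nat.pow_le_pow_right (by omega) (by omega)
  have hnn : n * n ≤ N * N := Nat.mul_le_mul (by omega) (by omega)
  have hNN : N ≤ N * N := Nat.le_mul_of_pos_left N (by omega)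
  have hL := listAddress_card adj
  rw [hadj.sum_length] at hL
  have hrun : Runs (200 * N ^ 200) (identificationProgram ε E) (initialState (inputWords adj k))
      (200 * (n * m + 1)) fun s _ => (IsYesInstance 𝓗 G k → s.reg 0 = 1) ∧
        (¬ IsYesInstance 𝓗 G k → s.reg 0 = 0) := by
    by_cases h0 : m = 0
    · have hG : G = ⊥ := by
        rwa [hm, Set.ncard_eq_zero, SimpleGraph.edgeSet_eq_empty] at h0
      subst hG
      exact runs_identificationProgram hadj hε (by omega) (by omega) (by omega)
        (fun h => absurd h0 h) (fun h => absurd h0 h)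
        fun _ s c h1 h2 h3 h4 hc => hzero n k _ s c h1 h2 h3 h4 (by omega) hc
    · have hmn : n ≤ n * m := Nat.le_mul_of_pos_right n (by omega)
      refine runs_identificationProgram hadj hε (by omega) (by omega) (by omega) (fun _ => ?_) ?_
        fun h => absurd h h0
      · rw [← hm, mul_add, Nat.mul_left_comm]
        omega
      · intro _ s _ hs
        rw [hs, hpos n G k h0]
        exact ⟨fun h => if_pos h, fun h => if_neg h⟩
  obtain ⟨t, s, h1, h2, h3⟩ := hrun
  exact ⟨t, s, h1, h2, h3⟩

/-- On graphs without edges, the answer is yes if `0 < n ≤ k + 1`. -/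
def edgelessPathProgram : RamProgram :=
  .seq (.add 17 2 4) (.ifLt 3 1 (.ifLt 17 1 (.const 0 0) (.const 0 1)) (.const 0 0))

theorem mainTheorem12 :
    SolvableInTime pathClass (fun n m => n * m + 1) ∧
      SolvableInTime linearForestClass (fun n m => n * m + 1) := by
  constructor
  · refine solvableInTime_of_compDiam (ε := 1) (E := edgelessPathProgram) le_rfl ?_ ?_
    · intro n G k hG
      rw [isYesInstance_pathClass_iff, and_iff_right]
      rcases Nat.eq_zero_or_pos n with rfl | hn
      · rw [Subsingleton.elim G ⊥] at hG
        simp at hG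
      · exact hn
    · intro n k B s c h1 h2 h3 h4 hB hc
      simp only [isYesInstance_pathClass_iff, compDiam_bot_zero, Finset.sum_const_zero, add_zero]
      refine .seq (.add ⟨by omega, by omega, .ifLt (by omega) (fun hlt => ?_) fun hlt => ?_⟩)
      · simp [h1, h3] at hlt
        refine .ifLt (by omega) (fun hlt' => ?_) fun hlt' => ?_
        all_goals
          simp [h1, h2, h4] at hlt'
          refine .const ⟨by omega, by omega, ?_⟩
          simp
          omega
      · simp [h1, h3] at hlt
        refine .const ⟨by omega, by omega, ?_⟩
        simp
        omega
  -- Here every component contributes its own extra vertex, so `ε = 0`. An edgeless graph, even the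
  -- empty one, is already a linear forest, and the answer is always yes.
  · refine solvableInTime_of_compDiam (ε := 0) (E := .const 0 1) (by omega) ?_ ?_
    · intro n G k _
      rw [isYesInstance_linearForestClass_iff, zero_add]
    · intro n k B s c _ _ _ _ hB hc
      refine .const ⟨by omega, by omega, ?_⟩
      have h : n ≤ ∑ r, compDiam (⊥ : SimpleGraph (Fin n)) 1 r := by
        simpa using Finset.card_nsmul_le_sum Finset.univ (compDiam (⊥ : SimpleGraph (Fin n)) 1) 1
          fun r _ => one_le_compDiam_bot_one r
      have : IsYesInstance linearForestClass (⊥ : SimpleGraph (Fin n)) k :=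
        isYesInstance_linearForestClass_iff.2 (by omega)
      simp [this]
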